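/- **Setting.** Let $T\ge 1$. For each period $t=1,\dots,T$ let $Y_t=\mathbf 1\{X_t'\beta_0+\alpha+\varepsilon_t\ge 0\}$, where $X_t$ is a random vector in $\mathbb R^p$, $\beta_0\in\mathbb R^p$, $\alpha$ is a real random variable, and the $(\varepsilon_t)_{t\le T}$ are i.i.d. standard logistic, independent of $(\alpha,X)$ with $X=(X_1,\dots,X_T)$. Assume that $E[\sum_{t,t'}(X_t-X_{t'})(X_t-X_{t'})']$ exists (all $X_{tj}-X_{t'j}$ have a finite second moment) and is nonsingular. Only $(X,Y)$ is observed, $Y=(Y_1,\dots,Y_T)$. Fix $k\in\{1,\dots,p\}$ and let $$\Delta=E\left[\frac{\partial P(Y_T=1\mid X,\alpha)}{\partial X_{Tk}}\right]$$ be the average marginal effect. Its sharp identified set is the closure of the set of values taken by the average marginal effect over all structures (slope parameter, joint law of $(X,\alpha)$, logistic errors) that satisfy the model above and generate the law of $(X,Y)$. Put $S=\sum_t Y_t$, $C_s(x,\beta)=\sum_{d\in\{0,1\}^T,\ \sum_t d_t=s}\exp(\sum_t d_t x_t'\beta)$, $$c_0(x)=E\left[\binom{T}{S}\frac{\exp(S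 x_T'\beta_0)}{C_S(x,\beta_0)}\,\Big|\,X=x\right],$$ and let $\lambda_{T+1}(x,\beta_0)$ be the coefficient of $u^{T+1}$ in $u(1-u)\prod_{t=1}^{T-1}\left(u(\exp((x_t-x_T)'\beta_0)-1)+1\right)$. **Proposition.** 1. The sharp identified set of $\Delta$ is a compact interval $[\underline\Delta,\overline\Delta]$, and its length satisfies $$\overline\Delta-\underline\Delta\le\frac{|\beta_{0k}|}{4^{T}}\,E\left[c_0(X)\,|\lambda_{T+1}(X,\beta_0)|\right]$$ (the right-hand expectation may be $+\infty$; when $\beta_{0k}=0$ the bound is read as $0$). 2. $\Delta$ is point identified (its sharp identified set is $\{\Delta\}$) if and only if $\beta_{0k}=0$ or $$\Pr\left(\min_{t<T}|(X_t-X_T)'\beta_0|=0\ \text{ or }\ |\mathrm{Supp}(\alpha\mid X)|\le T/2\right)=1,$$ where $\mathrm{Supp}(\alpha\mid X)$ is the support of the conditional distribution of $\alpha$ given $X$. -/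

import Mathlib

open MeasureTheory ProbabilityTheory
open scoped Matrix ENNReal

noncomputable section

namespace FELogit

/-- Covariate paths over `T = N + 1` periods, with `p` covariates per period: `x t j` is the `j`-th
covariate in period `t`. The last period `T` is `Fin.last N`; the periods `t < T` are the
`Fin.castSucc t` with `t : Fin N`. -/
abbrev Covariates (N p : ℕ) : Type := Fin (N + 1) → Fin p → ℝ

/-- The standard logistic distribution, with density `exp (-e) / (1 + exp (-e)) ^ 2`. -/
def logistic : Measure ℝ :=
  volume.withDensity fun e => ENNReal.ofReal (Real.exp (-e) / (1 + Real.exp (-e)) ^ 2)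

/-- The fixed effects logit model `Y_t = 1{X_t'β + α + ε_t ≥ 0}`, where the `ε_t` are i.i.d.,
independent of `(α, X)`, and logistic. -/
structure Model {Ω : Type*} [MeasurableSpace Ω] (μ : Measure Ω) {N p : ℕ} (β : Fin p → ℝ)
    (X : Ω → Covariates N p) (α : Ω → ℝ) (ε : Ω → Fin (N + 1) → ℝ)
    (Y : Ω → Fin (N + 1) → ℕ) : Prop where
  measurable_X : Measurable X
  measurable_α : Measurable α
  measurable_ε : Measurable ε
  measurable_Y : Measurable Y
  outcome : ∀ᵐ ω ∂μ, ∀ t, Y ω t = if 0 ≤ X ω t ⬝ᵥ β + α ω + ε ω t then 1 else 0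
  indep_errors : iIndepFun (fun t ω => ε ω t) μ
  law_errors : ∀ t, μ.map (fun ω => ε ω t) = logistic
  indep_individual : IndepFun (fun ω => (α ω, X ω)) ε μ

/-- The matrix `E[∑_{t,t'} (X_t - X_{t'}) (X_t - X_{t'})']`. -/
def variationMatrix {Ω : Type*} [MeasurableSpace Ω] (μ : Measure Ω) {N p : ℕ}
    (X : Ω → Covariates N p) : Matrix (Fin p) (Fin p) ℝ :=
  Matrix.of fun i j =>
    ∫ ω, ∑ t, ∑ t', (X ω t i - X ω t' i) * (X ω t j - X ω t' j) ∂μ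

/-- `E[∑_{t,t'} (X_t - X_{t'}) (X_t - X_{t'})']` exists and is nonsingular. -/
structure VaryingCovariates {Ω : Type*} [MeasurableSpace Ω] (μ : Measure Ω) {N p : ℕ}
    (X : Ω → Covariates N p) : Prop where
  integrable_sq : ∀ t t' j, Integrable (fun ω => (X ω t j - X ω t' j) ^ 2) μ
  nonsingular : (variationMatrix μ X).det ≠ 0

/-- The response probability `P(Y_t = 1 | X_t = v, α = a) = P(v'β + a + ε_t ≥ 0)`. -/
def responseProb {p : ℕ} (β : Fin p → ℝ) (v : Fin p → ℝ) (a : ℝ) : ℝ :=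
  logistic.real {e | 0 ≤ v ⬝ᵥ β + a + e}

/-- The average marginal effect `E[∂P(Y_T = 1 | X, α) / ∂X_{Tk}]`. -/
def averageMarginalEffect {Ω : Type*} [MeasurableSpace Ω] (μ : Measure Ω) {N p : ℕ}
    (k : Fin p) (β : Fin p → ℝ) (X : Ω → Covariates N p) (α : Ω → ℝ) : ℝ :=
  ∫ ω, deriv (fun s => responseProb β (Function.update (X ω (Fin.last N)) k s) (α ω))
    (X ω (Fin.last N) k) ∂μ

/-- The values of the average marginal effect that are rationalized by the model and by a joint
law `P` of the observed variables `(X, Y)`: those of all model structures (slope parameter, law of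
`(X, α)`, errors) that generate `P`. -/
def rationalizedEffects {N p : ℕ} (k : Fin p)
    (P : Measure (Covariates N p × (Fin (N + 1) → ℕ))) : Set ℝ :=
  {d | ∃ (Ω : Type) (_ : MeasurableSpace Ω) (μ : Measure Ω) (_ : IsProbabilityMeasure μ)
    (β : Fin p → ℝ) (X : Ω → Covariates N p) (α : Ω → ℝ) (ε : Ω → Fin (N + 1) → ℝ)
    (Y : Ω → Fin (N + 1) → ℕ),
    Model μ β X α ε Y ∧ μ.map (fun ω => (X ω, Y ω)) = P ∧
      averageMarginalEffect μ k β X α = d}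

/-- The sharp identified set of the average marginal effect when `(X, Y)` has law `P`: the closure
of the set of values that can be rationalized. -/
def identifiedSet {N p : ℕ} (k : Fin p)
    (P : Measure (Covariates N p × (Fin (N + 1) → ℕ))) : Set ℝ :=
  closure (rationalizedEffects k P)

/-- `C_s(x, β) = ∑ exp (∑_t d_t x_t'β)`, over the `d ∈ {0,1}^T` with `∑_t d_t = s`; such a `d` is
given by the set `A` of the `t` with `d_t = 1`. -/
def C {N p : ℕ} (s : ℕ) (x : Covariates N p) (β : Fin p → ℝ) : ℝ :=
  ∑ A ∈ (Finset.univ : Finset (Fin (N + 1))).powersetCard s, Real.exp (∑ t ∈ A, x t ⬝ᵥ β)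

/-- `c_t(x) = E[1{S ≥ t} binom(T - t, S - t) exp(S x_T'β) / C_S(x, β) | X = x]`, with
`S = ∑_t Y_t`: the mean under the conditional distribution of `S` given `X = x`. -/
def c {Ω : Type*} [MeasurableSpace Ω] (μ : Measure Ω) [IsFiniteMeasure μ] {N p : ℕ}
    (β : Fin p → ℝ) (X : Ω → Covariates N p) (Y : Ω → Fin (N + 1) → ℕ) (t : ℕ)
    (x : Covariates N p) : ℝ :=
  ∫ s, (if t ≤ s then
      ((N + 1 - t).choose (s - t) : ℝ) * Real.exp (s * (x (Fin.last N) ⬝ᵥ β)) / C s x β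
    else 0) ∂(condDistrib (fun ω => ∑ i, Y ω i) X μ x)

/-- The polynomial `u (1 - u) ∏_{t < T} (u (exp((x_t - x_T)'β) - 1) + 1)` in `u`. -/
def effectPolynomial {N p : ℕ} (x : Covariates N p) (β : Fin p → ℝ) : Polynomial ℝ :=
  Polynomial.X * (1 - Polynomial.X) *
    ∏ t : Fin N, (Polynomial.X *
      Polynomial.C (Real.exp ((x t.castSucc - x (Fin.last N)) ⬝ᵥ β) - 1) + 1)

/-- `λ_t(x, β)`, the coefficient of `u ^ t` in that polynomial. -/
def lam {N p : ℕ} (t : ℕ) (x : Covariates N p) (β : Fin p → ℝ) : ℝ :=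
  (effectPolynomial x β).coeff t

/-- `Supp(α | X = x)`, the topological support of the conditional distribution of `α` given
`X = x`. -/
def condSupport {Ω : Type*} [MeasurableSpace Ω] (μ : Measure Ω) [IsFiniteMeasure μ] {N p : ℕ}
    (X : Ω → Covariates N p) (α : Ω → ℝ) (x : Covariates N p) : Set ℝ :=
  (condDistrib α X μ x).support

end FELogit

end

namespace FELogit

open scoped NNReal

/-! ### Logistic distribution functions -/

variable {N p : ℕ}

/-! Write T = N + 1 and u = Λ(x_T'β + α), with Λ the logistic distribution function. Given X = x,
shifting the index by δ multiplies the odds of u by exp δ, so every outcome probability is a known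
positive constant times u^s (1 - u)^(T - s) / D(u), where s is the number of ones and D
(`ratioPolynomial`) has degree at most T - 1. These numerators span the polynomials of degree at
most T. Hence the law of Y given X = x reveals exactly the moments E[u^j / D(u)] for j ≤ T
(`moment_eq_of_responseLaw_eq`, `responseLaw_eq_of_moment_eq`). The marginal effect is β_k u (1 -
u), and u (1 - u) D(u) has degree at most T + 1, so the only unknown is the moment of order T + 1,
multiplied by λ_{T+1} (`effect_sub_effect`).

The slope is identified from ratios of probabilities of outcomes with a single one, in which α
cancels. The rationalized effects are therefore β_k times the mean effects over all conditional laws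
of α that reproduce these moments (`mem_rationalizedEffects_iff`). They form a bounded convex set,
whence the compact interval. For its length, the unknown monomial is traded for the monic Chebyshev
polynomial of degree T + 1 on [0, 1], of sup norm 1 / (2 · 4^T); two laws give 1 / 4^T times E[1 /
D(u)], which is c_0(x).

If λ_{T+1} = 0 nothing is unknown. If α has at most T/2 support points, the squared polynomial
vanishing at the corresponding values of u has degree at most T and moment zero; every competing law
shares this moment, so it lives on the same zeros, and a monic multiple of degree T + 1 has moment
zero for both laws.

Conversely, with more than T/2 support points, every nonzero polynomial of degree at most T that is
nonnegative on (0, 1) has positive moment, because its interior zeros are double (`moment_pos`). By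
separation the moment vector is interior to the moment cone (`StrictlyPositive.mem_interior`). There
is then room for two atomic laws with the same moments up to order T, one of which puts extra mass
at a point z, and their moments of order T + 1 differ. Choosing part of the atoms from a countable
list makes the construction measurable in x. Point identification then forces λ_{T+1} to vanish
almost surely on each of countably many sets covering the paths with large support
(`ae_of_integral_effect_eq`). -/

lemma logistic_Ici (c : ℝ) : logistic (Set.Ici c) = ENNReal.ofReal (Real.sigmoid (-c)) := by
  have hd : ∀ x : ℝ, HasDerivAt Real.sigmoid (Real.exp (-x) / (1 + Real.exp (-x)) ^ 2) x := by
    intro x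
    convert Real.hasDerivAt_sigmoid x using 1
    have : 0 < 1 + Real.exp (-x) := by positivity
    rw [Real.sigmoid_def]
    field_simp
    ring
  have hnn : ∀ x : ℝ, 0 ≤ Real.exp (-x) / (1 + Real.exp (-x)) ^ 2 := fun x => by positivity
  rw [logistic, withDensity_apply _ measurableSet_Ici, setLIntegral_congr Ioi_ae_eq_Ici.symm,
    ← ofReal_integral_eq_lintegral_ofReal]
  · rw [integral_Ioi_of_hasDerivAt_of_nonneg' (fun x _ => hd x) (fun x _ => hnn x)
      Real.tendsto_sigmoid_atTop, Real.sigmoid_neg]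
  · exact integrableOn_Ioi_deriv_of_nonneg' (fun x _ => hd x) (fun x _ => hnn x)
      Real.tendsto_sigmoid_atTop
  · exact Filter.Eventually.of_forall hnn

instance : IsProbabilityMeasure logistic := by
  constructor
  have h := tendsto_measure_iUnion_atTop (μ := logistic) (s := fun n : ℕ => Set.Ici (-(n : ℝ)))
    (fun a b hab => Set.Ici_subset_Ici.2 (by simpa using hab))
  have hU : (⋃ n : ℕ, Set.Ici (-(n : ℝ))) = Set.univ := by
    refine Set.eq_univ_of_forall fun x => Set.mem_iUnion.2 ?_
    obtain ⟨n, hn⟩ := exists_nat_ge (-x)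
    exact ⟨n, by simp only [Set.mem_Ici]; linarith⟩
  rw [hU] at h
  refine tendsto_nhds_unique h ?_
  simp only [Function.comp_def, logistic_Ici, neg_neg]
  have := (Real.tendsto_sigmoid_atTop.comp tendsto_natCast_atTop_atTop)
  simpa [Function.comp_def] using (ENNReal.continuous_ofReal.tendsto _).comp this

lemma logistic_threshold (c : ℝ) : logistic {e | 0 ≤ c + e} = ENNReal.ofReal (Real.sigmoid c) := by
  have : {e : ℝ | 0 ≤ c + e} = Set.Ici (-c) := by
    ext e; simp only [Set.mem_ofPred_eq, Set.mem_Ici]; constructor <;> intro h <;> linarith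
  rw [this, logistic_Ici, neg_neg]

lemma logistic_threshold_compl (c : ℝ) :
    logistic {e | ¬ 0 ≤ c + e} = ENNReal.ofReal (1 - Real.sigmoid c) := by
  have hm : MeasurableSet {e : ℝ | 0 ≤ c + e} := measurableSet_le (by fun_prop) (by fun_prop)
  have : {e : ℝ | ¬ 0 ≤ c + e} = {e | 0 ≤ c + e}ᶜ := rfl
  rw [this, prob_compl_eq_one_sub hm, logistic_threshold,
    ENNReal.ofReal_sub _ (Real.sigmoid_nonneg c), ENNReal.ofReal_one]

lemma responseProb_eq (β v : Fin p → ℝ) (a : ℝ) :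
    responseProb β v a = Real.sigmoid (v ⬝ᵥ β + a) := by
  rw [responseProb, Measure.real, logistic_threshold, ENNReal.toReal_ofReal (Real.sigmoid_nonneg _)]

lemma deriv_responseProb (k : Fin p) (β v : Fin p → ℝ) (a : ℝ) :
    deriv (fun s => responseProb β (Function.update v k s) a) (v k) =
      β k * (Real.sigmoid (v ⬝ᵥ β + a) * (1 - Real.sigmoid (v ⬝ᵥ β + a))) := by
  simp only [responseProb_eq]
  have hlin : ∀ s, Function.update v k s ⬝ᵥ β + a = (v ⬝ᵥ β + a) + (s - v k) * β k := by
    intro s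
    have : Function.update v k s = v + Pi.single k (s - v k) := by
      ext i
      by_cases h : i = k
      · subst h; simp
      · simp [h]
    rw [this, add_dotProduct, single_dotProduct]
    ring
  simp only [hlin]
  have h1 : HasDerivAt (fun s => (v ⬝ᵥ β + a) + (s - v k) * β k) (β k) (v k) := by
    simpa using (((hasDerivAt_id (v k)).sub_const (v k)).mul_const (β k)).const_add (v ⬝ᵥ β + a)
  have h2 := (Real.hasDerivAt_sigmoid ((v ⬝ᵥ β + a) + (v k - v k) * β k)).comp (v k) h1
  have := h2.deriv
  simp only [Function.comp_def, sub_self, zero_mul, add_zero] at this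
  rw [this]
  ring

/-! ### Outcome probabilities and model structures -/

/-- The probability, given `X = x` and `α = a`, that `A` is the set of the periods `t` with
`Y_t = 1`. -/
noncomputable def outcomeProb (β : Fin p → ℝ) (x : Covariates N p) (a : ℝ)
    (A : Finset (Fin (N + 1))) : ℝ :=
  ∏ t, if t ∈ A then Real.sigmoid (x t ⬝ᵥ β + a) else 1 - Real.sigmoid (x t ⬝ᵥ β + a)

/-- The outcome path with `Y_t = 1` exactly for `t ∈ A`. -/
def outcomePath (A : Finset (Fin (N + 1))) (t : Fin (N + 1)) : ℕ := if t ∈ A then 1 else 0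

lemma outcomePath_injective : Function.Injective (outcomePath (N := N)) := by
  intro A B h
  ext t
  have := congrFun h t
  simp only [outcomePath] at this
  by_cases hA : t ∈ A <;> by_cases hB : t ∈ B <;> simp_all

lemma sum_outcomePath (A : Finset (Fin (N + 1))) : ∑ t, outcomePath A t = A.card := by
  simp [outcomePath]

lemma outcomeProb_pos (β : Fin p → ℝ) (x : Covariates N p) (a : ℝ) (A : Finset (Fin (N + 1))) :
    0 < outcomeProb β x a A := by
  refine Finset.prod_pos fun t _ => ?_
  split_ifs
  · exact Real.sigmoid_pos _
  · linarith [Real.sigmoid_lt_one (x t ⬝ᵥ β + a)]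

@[fun_prop]
lemma measurable_index (β : Fin p → ℝ) (t : Fin (N + 1)) :
    Measurable fun q : Covariates N p × ℝ => q.1 t ⬝ᵥ β + q.2 := by
  simp only [dotProduct]
  fun_prop

@[fun_prop]
lemma measurable_sigmoid : Measurable Real.sigmoid := continuous_sigmoid.measurable

lemma measurable_outcomeProb (β : Fin p → ℝ) (A : Finset (Fin (N + 1))) :
    Measurable fun q : Covariates N p × ℝ => outcomeProb β q.1 q.2 A := by
  unfold outcomeProb
  refine Finset.measurable_prod _ fun t _ => ?_
  split_ifs
  · fun_prop
  · fun_prop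

lemma pi_logistic_outcome (β : Fin p → ℝ) (x : Covariates N p) (a : ℝ)
    (A : Finset (Fin (N + 1))) :
    Measure.pi (fun _ : Fin (N + 1) => logistic) {e | ∀ t, 0 ≤ x t ⬝ᵥ β + a + e t ↔ t ∈ A} =
      ENNReal.ofReal (outcomeProb β x a A) := by
  have : {e : Fin (N + 1) → ℝ | ∀ t, 0 ≤ x t ⬝ᵥ β + a + e t ↔ t ∈ A} =
      Set.pi Set.univ fun t => if t ∈ A then {e | 0 ≤ x t ⬝ᵥ β + a + e}
        else {e | ¬ 0 ≤ x t ⬝ᵥ β + a + e} := by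
    ext e
    simp only [Set.mem_ofPred_eq, Set.mem_pi, Set.mem_univ, true_imp_iff]
    refine forall_congr' fun t => ?_
    by_cases h : t ∈ A <;> simp [h]
  rw [this, Measure.pi_pi, outcomeProb, ENNReal.ofReal_prod_of_nonneg]
  · refine Finset.prod_congr rfl fun t _ => ?_
    split_ifs
    · exact logistic_threshold _
    · exact logistic_threshold_compl _
  · intro t _
    split_ifs
    · exact Real.sigmoid_nonneg _
    · linarith [Real.sigmoid_lt_one (x t ⬝ᵥ β + a)]

/-- The expectation of a function of the observed variables in a model structure. -/
lemma Model.lintegral_eq {Ω : Type*} [MeasurableSpace Ω] {μ : Measure Ω} [IsProbabilityMeasure μ]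
    {β : Fin p → ℝ} {X : Ω → Covariates N p} {α : Ω → ℝ} {ε : Ω → Fin (N + 1) → ℝ}
    {Y : Ω → Fin (N + 1) → ℕ} (h : Model μ β X α ε Y)
    {g : Covariates N p × (Fin (N + 1) → ℕ) → ℝ≥0∞} (hg : Measurable g) :
    ∫⁻ ω, g (X ω, Y ω) ∂μ =
      ∫⁻ q, ∑ A, g (q.1, outcomePath A) * ENNReal.ofReal (outcomeProb β q.1 q.2 A)
        ∂(μ.map fun ω => (X ω, α ω)) := by
  classical
  have hX := h.measurable_X
  have hα := h.measurable_α
  have hε := h.measurable_ε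
  have hind : IndepFun (fun ω => (X ω, α ω)) ε μ :=
    h.indep_individual.comp measurable_swap measurable_id
  have hpi : μ.map ε = Measure.pi fun _ => logistic := by
    have := (iIndepFun_iff_map_fun_eq_pi_map (fun t => by fun_prop)).1 h.indep_errors
    simpa only [h.law_errors] using this
  have hprod := (indepFun_iff_map_prod_eq_prod_map_map
    (by fun_prop) hε.aemeasurable).1 hind
  rw [hpi] at hprod
  have hS : ∀ A : Finset (Fin (N + 1)), MeasurableSet
      {r : (Covariates N p × ℝ) × (Fin (N + 1) → ℝ) |
        ∀ t, 0 ≤ r.1.1 t ⬝ᵥ β + r.1.2 + r.2 t ↔ t ∈ A} := by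
    intro A
    simp only [Set.ofPred_forall]
    refine MeasurableSet.iInter fun t => ?_
    have : MeasurableSet {r : (Covariates N p × ℝ) × (Fin (N + 1) → ℝ) |
        0 ≤ r.1.1 t ⬝ᵥ β + r.1.2 + r.2 t} := by
      refine measurableSet_le (by fun_prop) ?_
      exact ((measurable_index β t).comp measurable_fst).add (by fun_prop)
    by_cases ht : t ∈ A
    · simpa only [ht, iff_true] using this
    · simp only [ht, iff_false]
      exact this.compl
  have hgA : ∀ A : Finset (Fin (N + 1)),
      Measurable fun q : Covariates N p × ℝ => g (q.1, outcomePath A) := fun A => by fun_prop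
  -- Exactly one indicator is nonzero at each point, so `G` recovers g(X, Y) from X, α and the
  -- errors, and independence can be used.
  let G : (Covariates N p × ℝ) × (Fin (N + 1) → ℝ) → ℝ≥0∞ := fun r =>
    ∑ A, g (r.1.1, outcomePath A) * Set.indicator {r : (Covariates N p × ℝ) × (Fin (N + 1) → ℝ) |
        ∀ t, 0 ≤ r.1.1 t ⬝ᵥ β + r.1.2 + r.2 t ↔ t ∈ A} 1 r
  have hG : Measurable G := Finset.measurable_sum _ fun A _ =>
    ((hgA A).comp measurable_fst).mul (measurable_one.indicator (hS A))
  have hae : ∀ᵐ ω ∂μ, g (X ω, Y ω) = G ((X ω, α ω), ε ω) := by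
    filter_upwards [h.outcome] with ω hω
    let A₀ := Finset.univ.filter fun t => 0 ≤ X ω t ⬝ᵥ β + α ω + ε ω t
    have hY : Y ω = outcomePath A₀ := by
      ext t
      simp [hω t, outcomePath, A₀]
    simp only [G]
    rw [Finset.sum_eq_single A₀]
    · rw [Set.indicator_of_mem]
      · simp [hY]
      · intro t; simp [A₀]
    · intro A _ hA
      rw [Set.indicator_of_notMem, mul_zero]
      intro hmem
      apply hA
      ext t
      simp [A₀, hmem t]
    · simp
  rw [lintegral_congr_ae hae,
    ← lintegral_map (f := G) (g := fun ω => ((X ω, α ω), ε ω)) hG (by fun_prop), hprod,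
    lintegral_prod _ hG.aemeasurable]
  refine lintegral_congr fun q => ?_
  simp only [G]
  rw [lintegral_finsetSum' _ fun A _ => ?_]
  · refine Finset.sum_congr rfl fun A _ => ?_
    have hSq : MeasurableSet {e : Fin (N + 1) → ℝ | ∀ t, 0 ≤ q.1 t ⬝ᵥ β + q.2 + e t ↔ t ∈ A} :=
      measurable_prodMk_left (hS A)
    have hi : ∀ e : Fin (N + 1) → ℝ, Set.indicator
        {r : (Covariates N p × ℝ) × (Fin (N + 1) → ℝ) |
        ∀ t, 0 ≤ r.1.1 t ⬝ᵥ β + r.1.2 + r.2 t ↔ t ∈ A} (1 : (Covariates N p × ℝ) × (Fin (N + 1) → ℝ) → ℝ≥0∞) (q, e) =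
        Set.indicator {e : Fin (N + 1) → ℝ | ∀ t, 0 ≤ q.1 t ⬝ᵥ β + q.2 + e t ↔ t ∈ A} 1 e :=
      fun e => rfl
    simp only [hi]
    rw [lintegral_const_mul _ (measurable_one.indicator hSq), lintegral_indicator_one hSq,
      pi_logistic_outcome]
  · exact (((hgA A).comp measurable_fst).mul
      (measurable_one.indicator (hS A))).comp measurable_prodMk_left |>.aemeasurable

/-- Every law of `(X, α)` is part of a model structure. -/
lemma exists_model (β : Fin p → ℝ) (Γ : Measure (Covariates N p × ℝ)) [IsProbabilityMeasure Γ] :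
    ∃ (μ : Measure ((Covariates N p × ℝ) × (Fin (N + 1) → ℝ)))
      (_ : IsProbabilityMeasure μ) (Y : (Covariates N p × ℝ) × (Fin (N + 1) → ℝ) →
        Fin (N + 1) → ℕ),
      Model μ β (fun ω => ω.1.1) (fun ω => ω.1.2) (fun ω => ω.2) Y ∧
        μ.map (fun ω => (ω.1.1, ω.1.2)) = Γ := by
  classical
  have hsnd : (Γ.prod (Measure.pi fun _ : Fin (N + 1) => logistic)).map Prod.snd =
      Measure.pi fun _ => logistic := by
    rw [Measure.map_snd_prod]; simp
  have hfst : (Γ.prod (Measure.pi fun _ : Fin (N + 1) => logistic)).map Prod.fst = Γ := by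
    rw [Measure.map_fst_prod]; simp
  have hcoord : ∀ t, (Γ.prod (Measure.pi fun _ : Fin (N + 1) => logistic)).map
      (fun ω => ω.2 t) = logistic := by
    intro t
    have := (measurePreserving_eval (fun _ : Fin (N + 1) => logistic) t).map_eq
    rw [← hsnd, Measure.map_map (measurable_pi_apply t) measurable_snd] at this
    exact this
  refine ⟨Γ.prod (Measure.pi fun _ => logistic), inferInstance,
    fun ω t => if 0 ≤ ω.1.1 t ⬝ᵥ β + ω.1.2 + ω.2 t then 1 else 0, ⟨?_, ?_, ?_, ?_, ?_, ?_, ?_, ?_⟩,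
    hfst⟩
  · fun_prop
  · fun_prop
  · fun_prop
  · refine measurable_pi_lambda _ fun t => Measurable.ite ?_ measurable_const measurable_const
    refine measurableSet_le (by fun_prop) ?_
    exact ((measurable_index β t).comp measurable_fst).add (by fun_prop)
  · exact Filter.Eventually.of_forall fun ω t => rfl
  · refine (iIndepFun_iff_map_fun_eq_pi_map (fun t => by fun_prop)).2 ?_
    simp only [hcoord]
    exact hsnd
  · exact hcoord
  · refine (indepFun_iff_map_prod_eq_prod_map_map (by fun_prop) (by fun_prop)).2 ?_
    have h1 : (Γ.prod (Measure.pi fun _ : Fin (N + 1) => logistic)).map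
        (fun ω => (ω.1.2, ω.1.1)) = Γ.map Prod.swap := by
      conv_rhs => rw [← hfst]
      rw [Measure.map_map measurable_swap measurable_fst]
      rfl
    rw [h1, show (Γ.prod (Measure.pi fun _ : Fin (N + 1) => logistic)).map (fun ω => ω.2) = _
      from hsnd]
    conv_rhs => rw [← Measure.map_id (μ := Measure.pi fun _ : Fin (N + 1) => logistic)]
    rw [Measure.map_prod_map _ _ measurable_swap measurable_id]
    rfl

/-! ### Conditional laws of α and their observable implications -/

/-- The probability, given `X = x`, that `A` is the set of the periods `t` with `Y_t = 1`, when `ν`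
is the law of `α` given `X = x`. -/
noncomputable def responseLaw (β : Fin p → ℝ) (x : Covariates N p) (ν : Measure ℝ)
    (A : Finset (Fin (N + 1))) : ℝ≥0∞ :=
  ∫⁻ a, ENNReal.ofReal (outcomeProb β x a A) ∂ν

/-- The average of `Λ'(x_T'β + α)` when `ν` is the law of `α` given `X = x`. -/
noncomputable def effect (β : Fin p → ℝ) (x : Covariates N p) (ν : Measure ℝ) : ℝ :=
  ∫ a, Real.sigmoid (x (Fin.last N) ⬝ᵥ β + a) * (1 - Real.sigmoid (x (Fin.last N) ⬝ᵥ β + a)) ∂ν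

lemma measurable_responseLaw (β : Fin p → ℝ) (κ : Kernel (Covariates N p) ℝ) [IsSFiniteKernel κ]
    (A : Finset (Fin (N + 1))) : Measurable fun x => responseLaw β x (κ x) A :=
  Measurable.lintegral_kernel_prod_right' (κ := κ)
    (f := fun q : Covariates N p × ℝ => ENNReal.ofReal (outcomeProb β q.1 q.2 A))
    (measurable_outcomeProb β A).ennreal_ofReal

lemma outcomeProb_le_one (β : Fin p → ℝ) (x : Covariates N p) (a : ℝ) (A : Finset (Fin (N + 1))) :
    outcomeProb β x a A ≤ 1 := by
  refine Finset.prod_le_one (fun t _ => ?_) (fun t _ => ?_)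
  · split_ifs
    · exact Real.sigmoid_nonneg _
    · linarith [Real.sigmoid_lt_one (x t ⬝ᵥ β + a)]
  · split_ifs
    · exact Real.sigmoid_le_one _
    · linarith [Real.sigmoid_pos (x t ⬝ᵥ β + a)]

lemma responseLaw_le_one (β : Fin p → ℝ) (x : Covariates N p) (ν : Measure ℝ)
    [IsProbabilityMeasure ν] (A : Finset (Fin (N + 1))) : responseLaw β x ν A ≤ 1 := by
  calc responseLaw β x ν A ≤ ∫⁻ _, 1 ∂ν :=
        lintegral_mono fun a => ENNReal.ofReal_le_one.2 (outcomeProb_le_one β x a A)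
    _ = 1 := by simp

lemma measurable_outcomeProb_right (β : Fin p → ℝ) (x : Covariates N p)
    (A : Finset (Fin (N + 1))) : Measurable fun a : ℝ => ENNReal.ofReal (outcomeProb β x a A) :=
  ((measurable_outcomeProb β A).comp measurable_prodMk_left).ennreal_ofReal

lemma responseLaw_ne_zero (β : Fin p → ℝ) (x : Covariates N p) (ν : Measure ℝ)
    [IsProbabilityMeasure ν] (A : Finset (Fin (N + 1))) : responseLaw β x ν A ≠ 0 := by
  intro h
  have hm := measurable_outcomeProb_right β x A
  rw [responseLaw, lintegral_eq_zero_iff hm] at h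
  have h2 : ∀ᵐ _ ∂ν, False := by
    filter_upwards [h] with a ha
    have := outcomeProb_pos β x a A
    simp only [Pi.zero_apply, ENNReal.ofReal_eq_zero] at ha
    linarith
  rw [Filter.eventually_false_iff_eq_bot, ae_eq_bot] at h2
  exact IsProbabilityMeasure.ne_zero ν h2

lemma Model.map_fst_eq {Ω : Type*} [MeasurableSpace Ω] {μ : Measure Ω} {β : Fin p → ℝ}
    {X : Ω → Covariates N p} {α : Ω → ℝ} {ε : Ω → Fin (N + 1) → ℝ} {Y : Ω → Fin (N + 1) → ℕ}
    (h : Model μ β X α ε Y) :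
    μ.map X = (μ.map fun ω => (X ω, Y ω)).map Prod.fst := by
  rw [Measure.map_map measurable_fst (h.measurable_X.prodMk h.measurable_Y)]
  rfl

section models

variable {Ω : Type*} [MeasurableSpace Ω] {μ : Measure Ω} [IsProbabilityMeasure μ]
  {β : Fin p → ℝ} {X : Ω → Covariates N p} {α : Ω → ℝ} {ε : Ω → Fin (N + 1) → ℝ}
  {Y : Ω → Fin (N + 1) → ℕ}

lemma Model.lintegral_eq_kernel (h : Model μ β X α ε Y) {κ : Kernel (Covariates N p) ℝ}
    [IsMarkovKernel κ] (hκ : μ.map (fun ω => (X ω, α ω)) = (μ.map X) ⊗ₘ κ)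
    {g : Covariates N p × (Fin (N + 1) → ℕ) → ℝ≥0∞} (hg : Measurable g) :
    ∫⁻ ω, g (X ω, Y ω) ∂μ =
      ∫⁻ x, ∑ A, g (x, outcomePath A) * responseLaw β x (κ x) A ∂(μ.map X) := by
  have hm : ∀ A : Finset (Fin (N + 1)), Measurable fun q : Covariates N p × ℝ =>
      ENNReal.ofReal (outcomeProb β q.1 q.2 A) := fun A => (measurable_outcomeProb β A).ennreal_ofReal
  have hg' : ∀ A : Finset (Fin (N + 1)), Measurable fun q : Covariates N p × ℝ =>
      g (q.1, outcomePath A) :=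
    fun A => hg.comp (measurable_fst.prodMk measurable_const)
  have hF : Measurable fun q : Covariates N p × ℝ =>
      ∑ A, g (q.1, outcomePath A) * ENNReal.ofReal (outcomeProb β q.1 q.2 A) :=
    Finset.measurable_fun_sum _ fun A _ => (hg' A).mul (hm A)
  rw [h.lintegral_eq hg, hκ, Measure.lintegral_compProd hF]
  refine lintegral_congr fun x => ?_
  have h1 : ∀ A : Finset (Fin (N + 1)),
      ∫⁻ a, g (x, outcomePath A) * ENNReal.ofReal (outcomeProb β x a A) ∂(κ x) =
        g (x, outcomePath A) * responseLaw β x (κ x) A := fun A => lintegral_const_mul _ (measurable_outcomeProb_right β x A)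
  simp only [← h1]
  exact lintegral_finsetSum _ fun A _ => (measurable_outcomeProb_right β x A).const_mul _

lemma Model.setLIntegral_responseLaw (h : Model μ β X α ε Y) {κ : Kernel (Covariates N p) ℝ}
    [IsMarkovKernel κ] (hκ : μ.map (fun ω => (X ω, α ω)) = (μ.map X) ⊗ₘ κ)
    (A : Finset (Fin (N + 1))) {E : Set (Covariates N p)} (hE : MeasurableSet E) :
    ∫⁻ x in E, responseLaw β x (κ x) A ∂(μ.map X) =
      μ.map (fun ω => (X ω, Y ω)) (E ×ˢ {outcomePath A}) := by
  classical
  have hXY : Measurable fun ω => (X ω, Y ω) := h.measurable_X.prodMk h.measurable_Y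
  have hS : MeasurableSet (E ×ˢ {outcomePath A}) := hE.prod (measurableSet_singleton _)
  rw [← lintegral_indicator_one hS, lintegral_map (measurable_one.indicator hS) hXY,
    h.lintegral_eq_kernel hκ (measurable_one.indicator hS), ← lintegral_indicator hE]
  refine lintegral_congr fun x => ?_
  rw [Finset.sum_eq_single A]
  · by_cases hx : x ∈ E <;> simp [Set.indicator, hx]
  · intro B _ hB
    simp [Set.indicator, outcomePath_injective.eq_iff, hB]
  · simp

lemma Model.averageMarginalEffect_eq (h : Model μ β X α ε Y) {κ : Kernel (Covariates N p) ℝ}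
    [IsMarkovKernel κ] (hκ : μ.map (fun ω => (X ω, α ω)) = (μ.map X) ⊗ₘ κ) (k : Fin p) :
    averageMarginalEffect μ k β X α = β k * ∫ x, effect β x (κ x) ∂(μ.map X) := by
  have hXα : Measurable fun ω => (X ω, α ω) := h.measurable_X.prodMk h.measurable_α
  let F : Covariates N p × ℝ → ℝ := fun q => Real.sigmoid (q.1 (Fin.last N) ⬝ᵥ β + q.2) *
    (1 - Real.sigmoid (q.1 (Fin.last N) ⬝ᵥ β + q.2))
  have hF : Measurable F := by
    have := measurable_index β (Fin.last N)
    exact (measurable_sigmoid.comp this).mul ((measurable_sigmoid.comp this).const_sub 1)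
  have hbound : ∀ q, ‖F q‖ ≤ 1 := by
    intro q
    have h0 := Real.sigmoid_pos (q.1 (Fin.last N) ⬝ᵥ β + q.2)
    have h1 := Real.sigmoid_lt_one (q.1 (Fin.last N) ⬝ᵥ β + q.2)
    rw [Real.norm_eq_abs, abs_le]
    constructor <;> simp only [F] <;> nlinarith
  have : IsProbabilityMeasure (μ.map X) :=
    Measure.isProbabilityMeasure_map h.measurable_X.aemeasurable
  have hint : Integrable F ((μ.map X) ⊗ₘ κ) :=
    Integrable.of_bound hF.aestronglyMeasurable 1 (Filter.Eventually.of_forall hbound)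
  simp only [averageMarginalEffect, deriv_responseProb]
  rw [integral_const_mul]
  congr 1
  calc _ = ∫ ω, F (X ω, α ω) ∂μ := rfl
    _ = ∫ q, F q ∂(μ.map fun ω => (X ω, α ω)) :=
      (integral_map hXα.aemeasurable hF.aestronglyMeasurable).symm
    _ = _ := by
      rw [hκ, Measure.integral_compProd hint]
      rfl

variable {Ω' : Type*} [MeasurableSpace Ω'] {μ' : Measure Ω'} [IsProbabilityMeasure μ']
  {β' : Fin p → ℝ} {X' : Ω' → Covariates N p} {α' : Ω' → ℝ} {ε' : Ω' → Fin (N + 1) → ℝ}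
  {Y' : Ω' → Fin (N + 1) → ℕ}

/-- Over every measurable set of covariate paths, both response probabilities integrate to the same
observed mass; there are finitely many outcome sets, hence one common null set. -/
lemma Model.ae_responseLaw_eq (h : Model μ β X α ε Y) (h' : Model μ' β' X' α' ε' Y')
    (hP : μ'.map (fun ω => (X' ω, Y' ω)) = μ.map fun ω => (X ω, Y ω))
    {κ κ' : Kernel (Covariates N p) ℝ} [IsMarkovKernel κ] [IsMarkovKernel κ']
    (hκ : μ.map (fun ω => (X ω, α ω)) = (μ.map X) ⊗ₘ κ)
    (hκ' : μ'.map (fun ω => (X' ω, α' ω)) = (μ'.map X') ⊗ₘ κ') :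
    ∀ᵐ x ∂(μ.map X), ∀ A, responseLaw β' x (κ' x) A = responseLaw β x (κ x) A := by
  have hX : μ'.map X' = μ.map X := by rw [h.map_fst_eq, h'.map_fst_eq, hP]
  have : IsProbabilityMeasure (μ.map X) :=
    Measure.isProbabilityMeasure_map h.measurable_X.aemeasurable
  refine ae_all_iff.2 fun A => ?_
  refine ae_eq_of_forall_setLIntegral_eq_of_sigmaFinite (measurable_responseLaw β' κ' A)
    (measurable_responseLaw β κ A) fun E hE _ => ?_
  rw [h.setLIntegral_responseLaw hκ A hE, ← hP, ← h'.setLIntegral_responseLaw hκ' A hE, hX]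

end models

/-! ### Identification of the slope parameter -/

lemma outcomeProb_singleton (β : Fin p → ℝ) (x : Covariates N p) (a : ℝ) (t t' : Fin (N + 1)) :
    outcomeProb β x a {t} =
      Real.exp ((x t - x t') ⬝ᵥ β) * outcomeProb β x a {t'} := by
  -- The odds of Λ(v) are exp v, so a single one in period s multiplies the all-zero probability by
  -- exp(x_s'β + a); the ratio of two such probabilities is free of a.
  have key : ∀ s : Fin (N + 1), outcomeProb β x a {s} =
      Real.exp (x s ⬝ᵥ β + a) * ∏ r, (1 - Real.sigmoid (x r ⬝ᵥ β + a)) := by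
    intro s
    rw [outcomeProb, ← Finset.mul_prod_erase _ _ (Finset.mem_univ s),
      ← Finset.mul_prod_erase Finset.univ (fun r => 1 - Real.sigmoid (x r ⬝ᵥ β + a))
        (Finset.mem_univ s), ← mul_assoc]
    congr 1
    · rw [← Real.sigmoid_neg, ← Real.sigmoid_mul_rexp_neg]
      simp only [Finset.mem_singleton, if_true]
      rw [mul_left_comm, ← Real.exp_add]
      simp
    · refine Finset.prod_congr rfl fun r hr => ?_
      simp [Finset.ne_of_mem_erase hr]
  rw [key, key, ← mul_assoc, ← Real.exp_add, sub_dotProduct]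
  congr 2
  ring

lemma responseLaw_singleton (β : Fin p → ℝ) (x : Covariates N p) (ν : Measure ℝ)
    (t t' : Fin (N + 1)) :
    responseLaw β x ν {t} =
      ENNReal.ofReal (Real.exp ((x t - x t') ⬝ᵥ β)) * responseLaw β x ν {t'} := by
  have hm := measurable_outcomeProb_right β x {t'}
  rw [responseLaw, responseLaw, ← lintegral_const_mul _ hm]
  refine lintegral_congr fun a => ?_
  rw [outcomeProb_singleton β x a t t', ENNReal.ofReal_mul (Real.exp_pos _).le]

/-- The ratio of two single-one probabilities is exp((x_t - x_t')'β) in one structure and exp((x_t -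
x_t')'β') in the other. Cancelling is legitimate because these probabilities are positive and
finite. -/
lemma index_eq_of_responseLaw_eq {β β' : Fin p → ℝ} {x : Covariates N p} {ν ν' : Measure ℝ}
    [IsProbabilityMeasure ν] [IsProbabilityMeasure ν']
    (h : ∀ A, responseLaw β' x ν' A = responseLaw β x ν A) (t t' : Fin (N + 1)) :
    (x t - x t') ⬝ᵥ (β' - β) = 0 := by
  have h1 := responseLaw_singleton β x ν t t'
  have h2 := responseLaw_singleton β' x ν' t t'
  rw [h, h, h1] at h2
  have h3 := (ENNReal.mul_left_inj (responseLaw_ne_zero β x ν {t'})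
    ((responseLaw_le_one β x ν {t'}).trans_lt ENNReal.one_lt_top).ne).1 h2
  rw [ENNReal.ofReal_eq_ofReal_iff (Real.exp_pos _).le (Real.exp_pos _).le, Real.exp_eq_exp] at h3
  rw [dotProduct_sub, h3, sub_self]

/-- The slope parameter is identified. -/
lemma eq_zero_of_index_ae_eq_zero {Ω : Type*} [MeasurableSpace Ω] {μ : Measure Ω}
    {X : Ω → Covariates N p} (hX : Measurable X) (hvary : VaryingCovariates μ X) {δ : Fin p → ℝ}
    (h : ∀ᵐ ω ∂μ, ∀ t t', (X ω t - X ω t') ⬝ᵥ δ = 0) : δ = 0 := by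
  refine Matrix.eq_zero_of_mulVec_eq_zero hvary.nonsingular ?_
  have hint : ∀ t t' i j, Integrable
      (fun ω => (X ω t i - X ω t' i) * (X ω t j - X ω t' j)) μ := by
    intro t t' i j
    refine Integrable.mono' ((hvary.integrable_sq t t' i).add (hvary.integrable_sq t t' j))
      (by fun_prop) (Filter.Eventually.of_forall fun ω => ?_)
    simp only [Pi.add_apply, Real.norm_eq_abs, abs_le]
    constructor <;> nlinarith [sq_nonneg (X ω t i - X ω t' i + (X ω t j - X ω t' j)),
      sq_nonneg (X ω t i - X ω t' i - (X ω t j - X ω t' j)), sq_nonneg (X ω t i - X ω t' i),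
      sq_nonneg (X ω t j - X ω t' j)]
  ext i
  simp only [Matrix.mulVec, dotProduct, variationMatrix, Matrix.of_apply, Pi.zero_apply]
  -- Coordinate i of the matrix times δ is the mean of the sum of (X_t - X_t')_i (X_t - X_t')'δ,
  -- which is almost surely zero.
  simp only [← integral_mul_const]
  rw [← integral_finsetSum]
  · refine integral_eq_zero_of_ae ?_
    filter_upwards [h] with ω hω
    simp only [Finset.sum_mul, Pi.zero_apply]
    rw [Finset.sum_comm]
    refine Finset.sum_eq_zero fun t _ => ?_
    rw [Finset.sum_comm]
    refine Finset.sum_eq_zero fun t' _ => ?_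
    have := hω t t'
    simp only [dotProduct, Pi.sub_apply] at this
    simp only [mul_assoc]
    rw [← Finset.mul_sum, this, mul_zero]
  · exact fun j _ => (integrable_finsetSum _ fun t _ => integrable_finsetSum _ fun t' _ =>
      hint t t' i j).mul_const _

/-- The conditional laws of `α` given `X` of the model structures that generate the law of the
observed variables, and the average marginal effects in them. -/
lemma mem_rationalizedEffects_iff {Ω : Type*} [MeasurableSpace Ω] {μ : Measure Ω}
    [IsProbabilityMeasure μ] {β : Fin p → ℝ} {X : Ω → Covariates N p} {α : Ω → ℝ}
    {ε : Ω → Fin (N + 1) → ℝ} {Y : Ω → Fin (N + 1) → ℕ} (h : Model μ β X α ε Y)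
    (hvary : VaryingCovariates μ X) (k : Fin p) (d : ℝ) :
    d ∈ rationalizedEffects k (μ.map fun ω => (X ω, Y ω)) ↔
      ∃ κ : Kernel (Covariates N p) ℝ, IsMarkovKernel κ ∧
        (∀ᵐ x ∂(μ.map X), ∀ A,
          responseLaw β x (κ x) A = responseLaw β x (condDistrib α X μ x) A) ∧
        β k * ∫ x, effect β x (κ x) ∂(μ.map X) = d := by
  have hκ₀ : μ.map (fun ω => (X ω, α ω)) = (μ.map X) ⊗ₘ condDistrib α X μ :=
    (compProd_map_condDistrib h.measurable_α.aemeasurable).symm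
  have hXY : Measurable fun ω => (X ω, Y ω) := h.measurable_X.prodMk h.measurable_Y
  have hPX : IsProbabilityMeasure (μ.map X) :=
    Measure.isProbabilityMeasure_map h.measurable_X.aemeasurable
  constructor
  · rintro ⟨Ω', _, μ', _, β', X', α', ε', Y', h', hP, rfl⟩
    have hκ : μ'.map (fun ω => (X' ω, α' ω)) = (μ'.map X') ⊗ₘ condDistrib α' X' μ' :=
      (compProd_map_condDistrib h'.measurable_α.aemeasurable).symm
    have hX : μ'.map X' = μ.map X := by rw [h.map_fst_eq, h'.map_fst_eq, hP]
    have hlaw := h.ae_responseLaw_eq h' hP hκ₀ hκ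
    have hβ : β' - β = 0 := by
      refine eq_zero_of_index_ae_eq_zero h.measurable_X hvary ?_
      filter_upwards [ae_of_ae_map h.measurable_X.aemeasurable hlaw] with ω hω t t'
      exact index_eq_of_responseLaw_eq hω t t'
    obtain rfl : β' = β := sub_eq_zero.1 hβ
    exact ⟨condDistrib α' X' μ', inferInstance, hlaw,
      by rw [h'.averageMarginalEffect_eq hκ, hX]⟩
  · rintro ⟨κ, _, hlaw, rfl⟩
    -- Conversely, an admissible kernel is the conditional law of α in a structure with the same
    -- slope and the same law of X; equal response probabilities then give the same law of (X, Y).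
    obtain ⟨μ', _, Y', h', hΓ⟩ := exists_model β ((μ.map X) ⊗ₘ κ)
    have hX : μ'.map (fun ω => ω.1.1) = μ.map X := by
      have h1 : ((μ.map X) ⊗ₘ κ).map Prod.fst = μ.map X := Measure.fst_compProd _ _
      rw [← hΓ, Measure.map_map measurable_fst (by fun_prop)] at h1
      exact h1
    have hκ : μ'.map (fun ω => (ω.1.1, ω.1.2)) = (μ'.map fun ω => ω.1.1) ⊗ₘ κ := by rw [hΓ, hX]
    refine ⟨_, _, μ', inferInstance, β, _, _, _, Y', h', ?_, ?_⟩
    · ext S hS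
      rw [← lintegral_indicator_one hS, ← lintegral_indicator_one hS,
        lintegral_map (measurable_one.indicator hS) (h'.measurable_X.prodMk h'.measurable_Y),
        lintegral_map (measurable_one.indicator hS) hXY,
        h'.lintegral_eq_kernel hκ (measurable_one.indicator hS),
        h.lintegral_eq_kernel hκ₀ (measurable_one.indicator hS), hX]
      refine lintegral_congr_ae ?_
      filter_upwards [hlaw] with x hx
      simp only [hx]
    · rw [h'.averageMarginalEffect_eq hκ, hX]

/-! ### Reduction to polynomial moments of u = Λ(x_T'β + α) -/

/-- The polynomial `∏_{t < T} (u (exp((x_t - x_T)'β) - 1) + 1)` in `u`. -/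
noncomputable def ratioPolynomial (x : Covariates N p) (β : Fin p → ℝ) : Polynomial ℝ :=
  ∏ t : Fin N, (Polynomial.X *
      Polynomial.C (Real.exp ((x t.castSucc - x (Fin.last N)) ⬝ᵥ β) - 1) + 1)

lemma effectPolynomial_eq (x : Covariates N p) (β : Fin p → ℝ) :
    effectPolynomial x β = Polynomial.X * (1 - Polynomial.X) * ratioPolynomial x β := rfl

lemma eval_ratioPolynomial (x : Covariates N p) (β : Fin p → ℝ) (u : ℝ) :
    (ratioPolynomial x β).eval u =
      ∏ t : Fin N, (u * (Real.exp ((x t.castSucc - x (Fin.last N)) ⬝ᵥ β) - 1) + 1) := by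
  simp [ratioPolynomial, Polynomial.eval_prod]

lemma eval_ratioPolynomial_pos (x : Covariates N p) (β : Fin p → ℝ) {u : ℝ}
    (hu : u ∈ Set.Icc (0 : ℝ) 1) : 0 < (ratioPolynomial x β).eval u := by
  rw [eval_ratioPolynomial]
  refine Finset.prod_pos fun t _ => ?_
  have h := Real.exp_pos ((x t.castSucc - x (Fin.last N)) ⬝ᵥ β)
  rcases eq_or_lt_of_le hu.2 with h1 | h1
  · rw [h1]; linarith
  · nlinarith [mul_nonneg hu.1 h.le]

lemma sigmoid_mem_Icc (v : ℝ) : Real.sigmoid v ∈ Set.Icc (0 : ℝ) 1 :=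
  ⟨Real.sigmoid_nonneg v, Real.sigmoid_le_one v⟩

/-- A shift by δ multiplies the odds by exp δ. Clearing the denominator is what makes the model
polynomial in u. -/
lemma sigmoid_add (v δ : ℝ) :
    Real.sigmoid (v + δ) * (Real.sigmoid v * (Real.exp δ - 1) + 1) =
      Real.exp δ * Real.sigmoid v := by
  simp only [Real.sigmoid_def, neg_add, Real.exp_add, Real.exp_neg δ]
  have h1 := Real.exp_pos (-v)
  have h2 := Real.exp_pos δ
  field_simp
  ring

lemma one_sub_sigmoid_add (v δ : ℝ) :
    (1 - Real.sigmoid (v + δ)) * (Real.sigmoid v * (Real.exp δ - 1) + 1) =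
      1 - Real.sigmoid v := by
  rw [sub_mul, sigmoid_add]
  ring

/-- Each period contributes the denominator u (exp δ_t - 1) + 1, whether its outcome is one or zero.
In the last period δ = 0 and the denominator is 1, so only the periods t < T enter the product. -/
lemma outcomeProb_mul_ratio (β : Fin p → ℝ) (x : Covariates N p) (a : ℝ)
    (A : Finset (Fin (N + 1))) :
    outcomeProb β x a A *
        (ratioPolynomial x β).eval (Real.sigmoid (x (Fin.last N) ⬝ᵥ β + a)) =
      Real.exp (∑ t ∈ A, (x t - x (Fin.last N)) ⬝ᵥ β) *
        (Real.sigmoid (x (Fin.last N) ⬝ᵥ β + a) ^ A.card *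
          (1 - Real.sigmoid (x (Fin.last N) ⬝ᵥ β + a)) ^ (N + 1 - A.card)) := by
  set u := Real.sigmoid (x (Fin.last N) ⬝ᵥ β + a) with hu
  have hD : (ratioPolynomial x β).eval u =
      ∏ t, (u * (Real.exp ((x t - x (Fin.last N)) ⬝ᵥ β) - 1) + 1) := by
    rw [Fin.prod_univ_castSucc, eval_ratioPolynomial]
    simp
  have hcard : N + 1 - A.card = (Aᶜ).card := by simp [Finset.card_compl]
  rw [hD, outcomeProb, ← Finset.prod_mul_distrib, Real.exp_sum, hcard, ← Finset.prod_const,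
    ← Finset.prod_const, ← mul_assoc, ← Finset.prod_mul_distrib, ← Finset.prod_mul_prod_compl A]
  have hidx : ∀ t, x t ⬝ᵥ β + a =
      (x (Fin.last N) ⬝ᵥ β + a) + (x t - x (Fin.last N)) ⬝ᵥ β := by
    intro t; rw [sub_dotProduct]; ring
  congr 1
  · refine Finset.prod_congr rfl fun t ht => ?_
    rw [if_pos ht, hidx t, sigmoid_add]
  · refine Finset.prod_congr rfl fun t ht => ?_
    rw [if_neg (Finset.mem_compl.1 ht), hidx t, one_sub_sigmoid_add]

lemma integrable_moment (β : Fin p → ℝ) (x : Covariates N p) (ν : Measure ℝ) [IsFiniteMeasure ν]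
    (q : Polynomial ℝ) :
    Integrable (fun a => q.eval (Real.sigmoid (x (Fin.last N) ⬝ᵥ β + a)) /
      (ratioPolynomial x β).eval (Real.sigmoid (x (Fin.last N) ⬝ᵥ β + a))) ν := by
  obtain ⟨K, hK⟩ := (isCompact_Icc (a := (0 : ℝ)) (b := 1)).exists_bound_of_continuousOn
    (f := fun u => q.eval u / (ratioPolynomial x β).eval u)
    (q.continuous.continuousOn.div (ratioPolynomial x β).continuous.continuousOn
      fun u hu => (eval_ratioPolynomial_pos x β hu).ne')
  refine Integrable.of_bound ?_ K (Filter.Eventually.of_forall fun a => hK _ (sigmoid_mem_Icc _))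
  have h : Measurable fun a : ℝ => Real.sigmoid (x (Fin.last N) ⬝ᵥ β + a) := by fun_prop
  exact ((q.continuous.measurable.comp h).div
    ((ratioPolynomial x β).continuous.measurable.comp h)).aestronglyMeasurable

/-- When `ν` is the law of `α` given `X = x`, and `u = Λ(x_T'β + α)`, this maps a polynomial `q` to
the mean of `q(u) / ∏_{t < T} (u (exp((x_t - x_T)'β) - 1) + 1)`. -/
noncomputable def moment (β : Fin p → ℝ) (x : Covariates N p) (ν : Measure ℝ) [IsFiniteMeasure ν] :
    Polynomial ℝ →ₗ[ℝ] ℝ where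
  toFun q := ∫ a, q.eval (Real.sigmoid (x (Fin.last N) ⬝ᵥ β + a)) /
      (ratioPolynomial x β).eval (Real.sigmoid (x (Fin.last N) ⬝ᵥ β + a)) ∂ν
  map_add' q r := by
    rw [← integral_add (integrable_moment β x ν q) (integrable_moment β x ν r)]
    simp only [Polynomial.eval_add, add_div]
  map_smul' c q := by
    simp only [Polynomial.eval_smul, smul_eq_mul, mul_div_assoc, RingHom.id_apply]
    rw [integral_const_mul]

lemma moment_apply (β : Fin p → ℝ) (x : Covariates N p) (ν : Measure ℝ) [IsFiniteMeasure ν]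
    (q : Polynomial ℝ) :
    moment β x ν q = ∫ a, q.eval (Real.sigmoid (x (Fin.last N) ⬝ᵥ β + a)) /
      (ratioPolynomial x β).eval (Real.sigmoid (x (Fin.last N) ⬝ᵥ β + a)) ∂ν := rfl

lemma moment_mono (β : Fin p → ℝ) (x : Covariates N p) (ν : Measure ℝ) [IsFiniteMeasure ν]
    {q r : Polynomial ℝ} (h : ∀ u ∈ Set.Ioo (0 : ℝ) 1, q.eval u ≤ r.eval u) :
    moment β x ν q ≤ moment β x ν r := by
  rw [moment_apply, moment_apply]
  refine integral_mono (integrable_moment β x ν q) (integrable_moment β x ν r) fun a => ?_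
  exact div_le_div_of_nonneg_right (h _ ⟨Real.sigmoid_pos _, Real.sigmoid_lt_one _⟩)
    (eval_ratioPolynomial_pos x β (sigmoid_mem_Icc _)).le

lemma moment_nonneg (β : Fin p → ℝ) (x : Covariates N p) (ν : Measure ℝ) [IsFiniteMeasure ν]
    {q : Polynomial ℝ} (h : ∀ u ∈ Set.Ioo (0 : ℝ) 1, 0 ≤ q.eval u) : 0 ≤ moment β x ν q := by
  have := moment_mono β x ν (q := 0) (r := q) (by simpa using h)
  rwa [map_zero] at this

lemma responseLaw_eq (β : Fin p → ℝ) (x : Covariates N p) (ν : Measure ℝ) [IsFiniteMeasure ν]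
    (A : Finset (Fin (N + 1))) :
    responseLaw β x ν A = ENNReal.ofReal (Real.exp (∑ t ∈ A, (x t - x (Fin.last N)) ⬝ᵥ β) *
      moment β x ν (Polynomial.X ^ A.card * (1 - Polynomial.X) ^ (N + 1 - A.card))) := by
  have h : ∀ a, outcomeProb β x a A = Real.exp (∑ t ∈ A, (x t - x (Fin.last N)) ⬝ᵥ β) *
      ((Polynomial.X ^ A.card * (1 - Polynomial.X) ^ (N + 1 - A.card) : Polynomial ℝ).eval
        (Real.sigmoid (x (Fin.last N) ⬝ᵥ β + a)) /
      (ratioPolynomial x β).eval (Real.sigmoid (x (Fin.last N) ⬝ᵥ β + a))) := by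
    intro a
    have := (eval_ratioPolynomial_pos x β (sigmoid_mem_Icc (x (Fin.last N) ⬝ᵥ β + a))).ne'
    rw [← mul_div_assoc, eq_div_iff this, outcomeProb_mul_ratio]
    simp
  rw [responseLaw, moment_apply, ← integral_const_mul, ofReal_integral_eq_lintegral_ofReal]
  · simp only [h]
  · exact (integrable_moment β x ν _).const_mul _
  · refine Filter.Eventually.of_forall fun a => ?_
    simp only [Pi.zero_apply, ← h]
    exact (outcomeProb_pos β x a A).le

lemma bernstein_nonneg {s m : ℕ} {u : ℝ} (hu : u ∈ Set.Ioo (0 : ℝ) 1) :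
    0 ≤ (Polynomial.X ^ s * (1 - Polynomial.X) ^ m : Polynomial ℝ).eval u := by
  simp only [Polynomial.eval_mul, Polynomial.eval_pow, Polynomial.eval_X, Polynomial.eval_sub,
    Polynomial.eval_one]
  exact mul_nonneg (pow_nonneg hu.1.le _) (pow_nonneg (by linarith [hu.2]) _)

/-- Expand 1 = (X + (1 - X))^(n - j). For j ≤ n this puts the monomials in the span of the Bernstein
polynomials of degree n. -/
lemma X_pow_eq_sum_bernstein (n j : ℕ) : (Polynomial.X : Polynomial ℝ) ^ j =
    ∑ i ∈ Finset.range (n - j + 1), ((n - j).choose i : ℝ) •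
      (Polynomial.X ^ (j + i) * (1 - Polynomial.X) ^ (n - (j + i))) := by
  have h := (add_pow (Polynomial.X : Polynomial ℝ) (1 - Polynomial.X) (n - j))
  rw [add_sub_cancel, one_pow] at h
  conv_lhs => rw [← mul_one ((Polynomial.X : Polynomial ℝ) ^ j), h, Finset.mul_sum]
  refine Finset.sum_congr rfl fun i _ => ?_
  rw [Polynomial.smul_eq_C_mul, Polynomial.C_eq_natCast, Nat.sub_sub, pow_add]
  ring

/-- An outcome with s ones reveals the moment of u^s (1 - u)^(T - s) up to a positive factor, and
these polynomials span all degrees up to T. -/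
lemma moment_eq_of_responseLaw_eq {β : Fin p → ℝ} {x : Covariates N p} {ν ν' : Measure ℝ}
    [IsFiniteMeasure ν] [IsFiniteMeasure ν']
    (h : ∀ A, responseLaw β x ν' A = responseLaw β x ν A) {q : Polynomial ℝ}
    (hq : q.natDegree ≤ N + 1) : moment β x ν' q = moment β x ν q := by
  have hb : ∀ s ≤ N + 1,
      moment β x ν' (Polynomial.X ^ s * (1 - Polynomial.X) ^ (N + 1 - s)) =
        moment β x ν (Polynomial.X ^ s * (1 - Polynomial.X) ^ (N + 1 - s)) := by
    intro s hs
    obtain ⟨A, -, hA⟩ := Finset.exists_subset_card_eq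
      (s := (Finset.univ : Finset (Fin (N + 1)))) (n := s) (by simpa using hs)
    have := h A
    have he := Real.exp_pos (∑ t ∈ A, (x t - x (Fin.last N)) ⬝ᵥ β)
    rw [responseLaw_eq, responseLaw_eq, hA, ENNReal.ofReal_eq_ofReal_iff
      (mul_nonneg he.le (moment_nonneg _ _ _ fun u hu => bernstein_nonneg hu))
      (mul_nonneg he.le (moment_nonneg _ _ _ fun u hu => bernstein_nonneg hu))] at this
    exact mul_left_cancel₀ he.ne' this
  rw [q.as_sum_range_C_mul_X_pow]
  simp only [map_sum, ← Polynomial.smul_eq_C_mul, map_smul]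
  refine Finset.sum_congr rfl fun j hj => ?_
  congr 1
  have hj' : j ≤ N + 1 := by have := Finset.mem_range.1 hj; omega
  rw [X_pow_eq_sum_bernstein (N + 1) j]
  simp only [map_sum, map_smul]
  refine Finset.sum_congr rfl fun i hi => ?_
  rw [hb (j + i) (by have := Finset.mem_range.1 hi; omega)]

lemma natDegree_bernstein_le {s n : ℕ} (hs : s ≤ n) :
    (Polynomial.X ^ s * (1 - Polynomial.X) ^ (n - s) : Polynomial ℝ).natDegree ≤ n := by
  compute_degree
  omega

lemma responseLaw_eq_of_moment_eq {β : Fin p → ℝ} {x : Covariates N p} {ν ν' : Measure ℝ}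
    [IsFiniteMeasure ν] [IsFiniteMeasure ν']
    (h : ∀ q : Polynomial ℝ, q.natDegree ≤ N + 1 → moment β x ν' q = moment β x ν q)
    (A : Finset (Fin (N + 1))) : responseLaw β x ν' A = responseLaw β x ν A := by
  rw [responseLaw_eq, responseLaw_eq, h _ (natDegree_bernstein_le
    (A.card_le_univ.trans (by simp)))]

lemma effect_eq_moment (β : Fin p → ℝ) (x : Covariates N p) (ν : Measure ℝ) [IsFiniteMeasure ν] :
    effect β x ν = moment β x ν (effectPolynomial x β) := by
  rw [effect, moment_apply]
  refine integral_congr_ae (Filter.Eventually.of_forall fun a => ?_)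
  have := (eval_ratioPolynomial_pos x β (sigmoid_mem_Icc (x (Fin.last N) ⬝ᵥ β + a))).ne'
  simp only [effectPolynomial_eq, Polynomial.eval_mul, Polynomial.eval_X, Polynomial.eval_sub,
    Polynomial.eval_one]
  field_simp

lemma natDegree_ratioPolynomial_le (x : Covariates N p) (β : Fin p → ℝ) :
    (ratioPolynomial x β).natDegree ≤ N := by
  refine (Polynomial.natDegree_prod_le _ _).trans ?_
  refine (Finset.sum_le_card_nsmul _ _ 1 fun t _ => ?_).trans (by simp)
  compute_degree

lemma natDegree_effectPolynomial_le (x : Covariates N p) (β : Fin p → ℝ) :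
    (effectPolynomial x β).natDegree ≤ N + 2 := by
  rw [effectPolynomial_eq]
  have h1 : (Polynomial.X * (1 - Polynomial.X) : Polynomial ℝ).natDegree ≤ 2 := by compute_degree
  exact Polynomial.natDegree_mul_le.trans (by have := natDegree_ratioPolynomial_le x β; omega)

lemma lam_top_eq (x : Covariates N p) (β : Fin p → ℝ) :
    lam (N + 2) x β =
      -∏ t : Fin N, (Real.exp ((x t.castSucc - x (Fin.last N)) ⬝ᵥ β) - 1) := by
  have h1 : (Polynomial.X * (1 - Polynomial.X) : Polynomial ℝ).natDegree ≤ 2 := by compute_degree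
  have h2 : (Polynomial.X * (1 - Polynomial.X) : Polynomial ℝ).coeff 2 = -1 := by
    rw [Polynomial.coeff_X_mul]
    simp [Polynomial.coeff_one]
  have h3 : (ratioPolynomial x β).coeff N =
      ∏ t : Fin N, (Real.exp ((x t.castSucc - x (Fin.last N)) ⬝ᵥ β) - 1) := by
    have := Polynomial.coeff_prod_of_natDegree_le (s := (Finset.univ : Finset (Fin N)))
      (fun t => Polynomial.X * Polynomial.C
        (Real.exp ((x t.castSucc - x (Fin.last N)) ⬝ᵥ β) - 1) + 1) 1
      (fun t _ => by compute_degree)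
    rw [Finset.card_univ, Fintype.card_fin, mul_one] at this
    rw [ratioPolynomial, this]
    refine Finset.prod_congr rfl fun t _ => ?_
    rw [Polynomial.coeff_add, mul_comm, Polynomial.coeff_C_mul]
    simp [Polynomial.coeff_one]
  rw [lam, effectPolynomial_eq, add_comm N 2, Polynomial.coeff_mul_add_eq_of_natDegree_le h1
    (natDegree_ratioPolynomial_le x β), h2, h3, neg_one_mul]

/-- Removing λ_{T+1} q from the effect polynomial leaves degree at most T, hence a moment common to
both laws. The freedom in the monic q is the main tool: a Chebyshev polynomial bounds the
difference, one vanishing on the support kills it, and one vanishing at chosen nodes computes it. -/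
lemma effect_sub_effect {β : Fin p → ℝ} {x : Covariates N p} {ν ν' : Measure ℝ}
    [IsFiniteMeasure ν] [IsFiniteMeasure ν']
    (h : ∀ A, responseLaw β x ν' A = responseLaw β x ν A) {q : Polynomial ℝ} (hq : q.Monic)
    (hdeg : q.natDegree = N + 2) :
    effect β x ν' - effect β x ν =
      lam (N + 2) x β * (moment β x ν' q - moment β x ν q) := by
  have hr : (effectPolynomial x β - Polynomial.C (lam (N + 2) x β) * q).natDegree ≤ N + 1 := by
    rw [Polynomial.natDegree_le_iff_coeff_eq_zero]
    intro m hm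
    rcases eq_or_lt_of_le (show N + 2 ≤ m from hm) with rfl | hm
    · rw [Polynomial.coeff_sub, Polynomial.coeff_C_mul, ← hdeg, hq.coeff_natDegree, hdeg, mul_one,
        lam, sub_self]
    · rw [Polynomial.coeff_sub, Polynomial.coeff_C_mul,
        Polynomial.coeff_eq_zero_of_natDegree_lt
          ((natDegree_effectPolynomial_le x β).trans_lt hm),
        Polynomial.coeff_eq_zero_of_natDegree_lt (hdeg.trans_lt hm), mul_zero, sub_zero]
  have := moment_eq_of_responseLaw_eq h hr
  rw [← Polynomial.smul_eq_C_mul, map_sub, map_sub, map_smul, map_smul, smul_eq_mul,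
    smul_eq_mul] at this
  rw [effect_eq_moment, effect_eq_moment]
  linarith

/-! ### The Chebyshev bound -/

/-- The Chebyshev polynomial of `[0, 1]`. -/
lemma exists_monic_small (n : ℕ) : ∃ q : Polynomial ℝ, q.Monic ∧ q.natDegree = n + 1 ∧
    ∀ u ∈ Set.Ioo (0 : ℝ) 1, |q.eval u| ≤ (2 * 4 ^ n)⁻¹ := by
  let l : Polynomial ℝ := Polynomial.C 2 * Polynomial.X + Polynomial.C (-1)
  have hl : l.natDegree = 1 := Polynomial.natDegree_linear (by norm_num)
  have hlc : l.leadingCoeff = 2 := Polynomial.leadingCoeff_linear (by norm_num)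
  have hT : (Polynomial.Chebyshev.T ℝ ((n + 1 : ℕ) : ℤ)).natDegree = n + 1 := by
    rw [Polynomial.Chebyshev.natDegree_T, Int.natAbs_natCast]
  have hTl : (Polynomial.Chebyshev.T ℝ ((n + 1 : ℕ) : ℤ)).leadingCoeff = 2 ^ n := by
    rw [Polynomial.Chebyshev.leadingCoeff_T, Int.natAbs_natCast, Nat.add_sub_cancel]
  -- The Chebyshev polynomial of degree n + 1 has leading coefficient 2^n, and the affine map of [0,
  -- 1] onto [-1, 1] contributes 2^(n + 1).
  have h24 : (2 : ℝ) ^ n * 2 ^ (n + 1) = 2 * 4 ^ n := by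
    rw [pow_succ, show (4 : ℝ) = 2 * 2 by norm_num, mul_pow]; ring
  have hpos : (0 : ℝ) < 2 * 4 ^ n := by positivity
  refine ⟨Polynomial.C (2 * 4 ^ n : ℝ)⁻¹ * (Polynomial.Chebyshev.T ℝ ((n + 1 : ℕ) : ℤ)).comp l,
    ?_, ?_, fun u hu => ?_⟩
  · rw [Polynomial.Monic, Polynomial.leadingCoeff_mul, Polynomial.leadingCoeff_C,
      Polynomial.leadingCoeff_comp (by rw [hl]; exact one_ne_zero), hTl, hlc, hT, h24,
      inv_mul_cancel₀ hpos.ne']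
  · rw [Polynomial.natDegree_C_mul (inv_ne_zero hpos.ne'), Polynomial.natDegree_comp, hT, hl,
      mul_one]
  · rw [Polynomial.eval_mul, Polynomial.eval_C, Polynomial.eval_comp, abs_mul,
      abs_of_pos (inv_pos.2 hpos)]
    refine mul_le_of_le_one_right (inv_pos.2 hpos).le
      (Polynomial.Chebyshev.abs_eval_T_real_le_one _ ?_)
    simp only [l, Polynomial.eval_add, Polynomial.eval_mul, Polynomial.eval_C, Polynomial.eval_X]
    rw [abs_le]
    constructor <;> linarith [hu.1, hu.2]

lemma abs_moment_le (β : Fin p → ℝ) (x : Covariates N p) (ν : Measure ℝ) [IsFiniteMeasure ν]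
    {q : Polynomial ℝ} {K : ℝ} (h : ∀ u ∈ Set.Ioo (0 : ℝ) 1, |q.eval u| ≤ K) :
    |moment β x ν q| ≤ K * moment β x ν 1 := by
  have hK : ∀ c : ℝ, c * moment β x ν 1 = moment β x ν (Polynomial.C c) := by
    intro c
    rw [← mul_one (Polynomial.C c), ← Polynomial.smul_eq_C_mul, map_smul, smul_eq_mul]
  rw [abs_le, ← neg_mul, hK, hK]
  constructor <;> refine moment_mono β x ν fun u hu => ?_ <;> rw [Polynomial.eval_C]
  · exact (abs_le.1 (h u hu)).1
  · exact (abs_le.1 (h u hu)).2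

lemma abs_effect_sub_le {β : Fin p → ℝ} {x : Covariates N p} {ν ν' : Measure ℝ}
    [IsFiniteMeasure ν] [IsFiniteMeasure ν']
    (h : ∀ A, responseLaw β x ν' A = responseLaw β x ν A) :
    |effect β x ν' - effect β x ν| ≤ |lam (N + 2) x β| * moment β x ν 1 / 4 ^ (N + 1) := by
  -- Here the degree is T + 1 and the sup norm 1 / (2 · 4^T). The two laws share the moment of order
  -- zero, so each contributes half of the bound.
  obtain ⟨q, hq, hdeg, hb⟩ := exists_monic_small (N + 1)
  have h1 : moment β x ν' 1 = moment β x ν 1 := moment_eq_of_responseLaw_eq h (by simp)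
  have hν := abs_moment_le β x ν hb
  have hν' := abs_moment_le β x ν' hb
  rw [h1] at hν'
  rw [effect_sub_effect h hq hdeg, abs_mul, mul_div_assoc]
  refine mul_le_mul_of_nonneg_left ((abs_sub _ _).trans ((add_le_add hν' hν).trans_eq ?_))
    (abs_nonneg _)
  rw [mul_inv]
  ring

/-! ### Nonnegative polynomials and the size of the support -/

lemma moment_eq_zero_iff {β : Fin p → ℝ} {x : Covariates N p} {ν : Measure ℝ} [IsFiniteMeasure ν]
    {q : Polynomial ℝ} (hq : ∀ u ∈ Set.Ioo (0 : ℝ) 1, 0 ≤ q.eval u) :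
    moment β x ν q = 0 ↔ ∀ᵐ a ∂ν, q.eval (Real.sigmoid (x (Fin.last N) ⬝ᵥ β + a)) = 0 := by
  rw [moment_apply, integral_eq_zero_iff_of_nonneg _ (integrable_moment β x ν q)]
  · refine Filter.eventually_congr (Filter.Eventually.of_forall fun a => ?_)
    rw [Pi.zero_apply, div_eq_zero_iff]
    exact or_iff_left (eval_ratioPolynomial_pos x β (sigmoid_mem_Icc _)).ne'
  · exact fun a => div_nonneg (hq _ ⟨Real.sigmoid_pos _, Real.sigmoid_lt_one _⟩)
      (eval_ratioPolynomial_pos x β (sigmoid_mem_Icc _)).le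

lemma moment_mul_eq_zero {β : Fin p → ℝ} {x : Covariates N p} {ν : Measure ℝ} [IsFiniteMeasure ν]
    {q : Polynomial ℝ}
    (hq : ∀ᵐ a ∂ν, q.eval (Real.sigmoid (x (Fin.last N) ⬝ᵥ β + a)) = 0) (r : Polynomial ℝ) :
    moment β x ν (r * q) = 0 := by
  rw [moment_apply]
  refine integral_eq_zero_of_ae ?_
  filter_upwards [hq] with a ha
  simp [ha]

/-- A zero in the open interval is a local minimum, so the derivative vanishes there too and the
root is at least double. -/
lemma two_mul_card_le_natDegree {q : Polynomial ℝ} (hq0 : q ≠ 0)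
    (hq : ∀ u ∈ Set.Ioo (0 : ℝ) 1, 0 ≤ q.eval u) (R : Finset ℝ)
    (hR : ∀ u ∈ R, u ∈ Set.Ioo (0 : ℝ) 1 ∧ q.eval u = 0) : 2 * R.card ≤ q.natDegree := by
  classical
  have hmult : ∀ u ∈ R, 2 ≤ q.roots.count u := by
    intro u hu
    obtain ⟨hu1, hu2⟩ := hR u hu
    rw [Polynomial.count_roots]
    refine (Polynomial.one_lt_rootMultiplicity_iff_isRoot hq0).2 ⟨hu2, ?_⟩
    have hmin : IsLocalMin (fun v => q.eval v) u := by
      filter_upwards [isOpen_Ioo.mem_nhds hu1] with v hv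
      rw [hu2]
      exact hq v hv
    have := hmin.deriv_eq_zero
    rwa [Polynomial.deriv] at this
  have hsub : R ⊆ q.roots.toFinset := by
    intro u hu
    rw [Multiset.mem_toFinset, ← Multiset.count_pos]
    exact lt_of_lt_of_le two_pos (hmult u hu)
  calc 2 * R.card = ∑ u ∈ R, 2 := by rw [Finset.sum_const, smul_eq_mul, mul_comm]
    _ ≤ ∑ u ∈ R, q.roots.count u := Finset.sum_le_sum hmult
    _ ≤ ∑ u ∈ q.roots.toFinset, q.roots.count u := Finset.sum_le_sum_of_subset hsub
    _ = q.roots.card := Multiset.toFinset_sum_count_eq _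
    _ ≤ q.natDegree := Polynomial.card_roots' q

/-- A zero moment forces q(u) = 0 almost surely, hence on the whole support because the zero set is
closed. Since Λ is injective, distinct support points give distinct double roots in (0, 1), too many
for the degree. -/
lemma moment_pos {β : Fin p → ℝ} {x : Covariates N p} {ν : Measure ℝ} [IsFiniteMeasure ν]
    {n : ℕ} (hν : ¬ 2 * ν.support.encard ≤ (n : ℕ∞)) {q : Polynomial ℝ} (hq0 : q ≠ 0)
    (hdeg : q.natDegree ≤ n) (hq : ∀ u ∈ Set.Ioo (0 : ℝ) 1, 0 ≤ q.eval u) :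
    0 < moment β x ν q := by
  classical
  refine lt_of_le_of_ne (moment_nonneg β x ν hq) fun h0 => hν ?_
  have hae := (moment_eq_zero_iff hq).1 h0.symm
  have hcl : IsClosed {a : ℝ | q.eval (Real.sigmoid (x (Fin.last N) ⬝ᵥ β + a)) = 0} := by
    refine isClosed_eq ?_ continuous_const
    exact q.continuous.comp (continuous_sigmoid.comp (by fun_prop))
  have hsupp := Measure.support_subset_of_isClosed hcl hae
  set f : ℝ → ℝ := fun a => Real.sigmoid (x (Fin.last N) ⬝ᵥ β + a) with hf
  have hinj : Function.Injective f := fun a b hab =>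
    add_left_cancel (Real.sigmoid_injective hab)
  let R := q.roots.toFinset.filter fun u => u ∈ Set.Ioo (0 : ℝ) 1
  have himg : f '' ν.support ⊆ (R : Set ℝ) := by
    rintro _ ⟨a, ha, rfl⟩
    simp only [R, Finset.coe_filter, Multiset.mem_toFinset, Polynomial.mem_roots hq0,
      Polynomial.IsRoot]
    exact ⟨hsupp ha, Real.sigmoid_pos _, Real.sigmoid_lt_one _⟩
  have hcard := two_mul_card_le_natDegree hq0 hq R (fun u hu => by
    simp only [R, Finset.mem_filter, Multiset.mem_toFinset, Polynomial.mem_roots hq0,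
      Polynomial.IsRoot] at hu
    exact ⟨hu.2, hu.1⟩)
  calc 2 * ν.support.encard = 2 * (f '' ν.support).encard := by rw [hinj.encard_image]
    _ ≤ 2 * (R : Set ℝ).encard := by gcongr
    _ = ((2 * R.card : ℕ) : ℕ∞) := by rw [Set.encard_coe_eq_coe_finsetCard]; push_cast; rfl
    _ ≤ n := by exact_mod_cast hcard.trans hdeg

lemma effect_eq_of_encard_support_le {β : Fin p → ℝ} {x : Covariates N p} {ν ν' : Measure ℝ}
    [IsFiniteMeasure ν] [IsFiniteMeasure ν']
    (h : ∀ A, responseLaw β x ν' A = responseLaw β x ν A)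
    (hν : 2 * ν.support.encard ≤ ((N + 1 : ℕ) : ℕ∞)) : effect β x ν' = effect β x ν := by
  have hfin : ν.support.Finite := by
    refine Set.finite_of_encard_le_coe (k := N + 1) (le_trans ?_ hν)
    exact le_mul_of_one_le_left zero_le (by norm_num)
  let F := hfin.toFinset
  have hF : 2 * F.card ≤ N + 1 := by
    rw [hfin.encard_eq_coe_toFinset_card] at hν
    exact_mod_cast hν
  -- The square makes this nonnegative, so a zero moment is equivalent to vanishing almost surely;
  -- its degree is still at most T, so ν' has the same moment.
  let q₀ : Polynomial ℝ := (∏ a ∈ F,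
    (Polynomial.X - Polynomial.C (Real.sigmoid (x (Fin.last N) ⬝ᵥ β + a)))) ^ 2
  have hmon : q₀.Monic := (Polynomial.monic_prod_of_monic _ _
    fun a _ => Polynomial.monic_X_sub_C _).pow 2
  have hdeg₀ : q₀.natDegree = 2 * F.card := by
    rw [(Polynomial.monic_prod_of_monic _ _ fun a _ => Polynomial.monic_X_sub_C _).natDegree_pow,
      Polynomial.natDegree_prod_of_monic _ _ fun a _ => Polynomial.monic_X_sub_C _]
    simp
  have hnn : ∀ u ∈ Set.Ioo (0 : ℝ) 1, 0 ≤ q₀.eval u := fun u _ => by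
    rw [Polynomial.eval_pow]; positivity
  have hae : ∀ᵐ a ∂ν, q₀.eval (Real.sigmoid (x (Fin.last N) ⬝ᵥ β + a)) = 0 := by
    filter_upwards [Measure.support_mem_ae (μ := ν)] with a ha
    rw [Polynomial.eval_pow, Polynomial.eval_prod,
      Finset.prod_eq_zero (hfin.mem_toFinset.2 ha) (by simp), zero_pow two_ne_zero]
  have hae' : ∀ᵐ a ∂ν', q₀.eval (Real.sigmoid (x (Fin.last N) ⬝ᵥ β + a)) = 0 := by
    rw [← moment_eq_zero_iff hnn, moment_eq_of_responseLaw_eq h (hdeg₀.trans_le hF),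
      moment_eq_zero_iff hnn]
    exact hae
  -- The power of X only raises the degree to T + 1; the moment stays zero for both laws.
  have hq : (Polynomial.X ^ (N + 2 - 2 * F.card) * q₀ : Polynomial ℝ).natDegree = N + 2 := by
    rw [(Polynomial.monic_X_pow _).natDegree_mul hmon, hdeg₀, Polynomial.natDegree_X_pow]
    omega
  have := effect_sub_effect h ((Polynomial.monic_X_pow _).mul hmon) hq
  rw [moment_mul_eq_zero hae, moment_mul_eq_zero hae', sub_self, mul_zero] at this
  exact sub_eq_zero.1 this

lemma effect_eq_of_lam_eq_zero {β : Fin p → ℝ} {x : Covariates N p} {ν ν' : Measure ℝ}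
    [IsFiniteMeasure ν] [IsFiniteMeasure ν']
    (h : ∀ A, responseLaw β x ν' A = responseLaw β x ν A) (hlam : lam (N + 2) x β = 0) :
    effect β x ν' = effect β x ν := by
  have := effect_sub_effect h (Polynomial.monic_X_pow (N + 2)) (Polynomial.natDegree_X_pow _)
  rw [hlam, zero_mul] at this
  exact sub_eq_zero.1 this

lemma lam_top_eq_zero_iff (x : Covariates N p) (β : Fin p → ℝ) :
    lam (N + 2) x β = 0 ↔ ∃ t : Fin N, |(x t.castSucc - x (Fin.last N)) ⬝ᵥ β| = 0 := by
  rw [lam_top_eq, neg_eq_zero, Finset.prod_eq_zero_iff]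
  simp [sub_eq_zero]

/-! ### The coefficient c_0 as a moment -/

lemma C_pos {s : ℕ} (hs : s ≤ N + 1) (x : Covariates N p) (β : Fin p → ℝ) : 0 < C s x β := by
  refine Finset.sum_pos (fun A _ => Real.exp_pos _) ?_
  exact Finset.powersetCard_nonempty.2 (by simpa using hs)

lemma C_nonneg (s : ℕ) (x : Covariates N p) (β : Fin p → ℝ) : 0 ≤ C s x β :=
  Finset.sum_nonneg fun _ _ => (Real.exp_pos _).le

/-- The function of `(X, S)` with conditional mean `c_0`. -/
noncomputable def weight (β : Fin p → ℝ) (x : Covariates N p) (s : ℕ) : ℝ :=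
  ((N + 1).choose s : ℝ) * Real.exp (s * (x (Fin.last N) ⬝ᵥ β)) / C s x β

lemma weight_nonneg (β : Fin p → ℝ) (x : Covariates N p) (s : ℕ) : 0 ≤ weight β x s :=
  div_nonneg (by positivity) (C_nonneg s x β)

/-- Over the sets A of size s the exponentials add up to C_s exp(-s x_T'β), so the weight leaves
just the binomial coefficient, and the Bernstein polynomials with these coefficients sum to 1. This
is why c_0(x) is the mean of 1 / D(u). -/
lemma sum_weight (β : Fin p → ℝ) (x : Covariates N p) (ν : Measure ℝ) [IsFiniteMeasure ν] :
    ∑ A : Finset (Fin (N + 1)), weight β x A.card *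
      (Real.exp (∑ t ∈ A, (x t - x (Fin.last N)) ⬝ᵥ β) *
        moment β x ν (Polynomial.X ^ A.card * (1 - Polynomial.X) ^ (N + 1 - A.card))) =
      moment β x ν 1 := by
  have h1 := congrArg (moment β x ν) (X_pow_eq_sum_bernstein (N + 1) 0)
  simp only [pow_zero, Nat.sub_zero, zero_add, map_sum, map_smul, smul_eq_mul] at h1
  rw [h1, ← Finset.powerset_univ, Finset.sum_powerset, Finset.card_univ, Fintype.card_fin]
  refine Finset.sum_congr rfl fun s hs => ?_
  have hs' : s ≤ N + 1 := by have := Finset.mem_range.1 hs; omega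
  set m := moment β x ν (Polynomial.X ^ s * (1 - Polynomial.X) ^ (N + 1 - s)) with hm
  calc _ = ∑ A ∈ (Finset.univ : Finset (Fin (N + 1))).powersetCard s,
        Real.exp (∑ t ∈ A, x t ⬝ᵥ β) *
          (weight β x s * Real.exp (-(s * (x (Fin.last N) ⬝ᵥ β))) * m) := by
        refine Finset.sum_congr rfl fun A hA => ?_
        have hc := (Finset.mem_powersetCard.1 hA).2
        rw [hc, ← hm]
        have : ∑ t ∈ A, (x t - x (Fin.last N)) ⬝ᵥ β =
            ∑ t ∈ A, x t ⬝ᵥ β + -(s * (x (Fin.last N) ⬝ᵥ β)) := by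
          simp only [sub_dotProduct]
          rw [Finset.sum_sub_distrib, Finset.sum_const, hc, nsmul_eq_mul]
          ring
        rw [this, Real.exp_add]
        ring
    _ = C s x β * (weight β x s * Real.exp (-(s * (x (Fin.last N) ⬝ᵥ β))) * m) := by
        rw [← Finset.sum_mul, C]
    _ = ((N + 1).choose s : ℝ) * m := by
        have := (C_pos hs' x β).ne'
        rw [weight, Real.exp_neg]
        field_simp

lemma measurable_dotProduct_const (β : Fin p → ℝ) (t : Fin (N + 1)) :
    Measurable fun x : Covariates N p => x t ⬝ᵥ β := by
  simp only [dotProduct]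
  fun_prop

lemma measurable_weight (β : Fin p → ℝ) (s : ℕ) :
    Measurable fun x : Covariates N p => weight β x s := by
  have h := measurable_dotProduct_const (N := N) β
  unfold weight C
  refine Measurable.div ?_ (Finset.measurable_fun_sum _ fun A _ => ?_)
  · exact (((h _).const_mul _).exp).const_mul _
  · exact (Finset.measurable_fun_sum _ fun t _ => h t).exp

lemma measurable_lam_top (β : Fin p → ℝ) :
    Measurable fun x : Covariates N p => lam (N + 2) x β := by
  have h := measurable_dotProduct_const (N := N) β
  simp only [lam_top_eq, sub_dotProduct]
  refine (Finset.measurable_fun_prod _ fun t _ => ?_).neg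
  exact ((h _).sub (h _)).exp.sub_const 1

section law

variable {Ω : Type*} [MeasurableSpace Ω] {μ : Measure Ω} [IsProbabilityMeasure μ]
  {β : Fin p → ℝ} {X : Ω → Covariates N p} {α : Ω → ℝ} {ε : Ω → Fin (N + 1) → ℝ}
  {Y : Ω → Fin (N + 1) → ℕ}

lemma ofReal_c_zero (x : Covariates N p) :
    ENNReal.ofReal (c μ β X Y 0 x) =
      ∫⁻ s, ENNReal.ofReal (weight β x s) ∂(condDistrib (fun ω => ∑ i, Y ω i) X μ x) := by
  have hc : c μ β X Y 0 x =
      ∫ s, weight β x s ∂(condDistrib (fun ω => ∑ i, Y ω i) X μ x) := by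
    simp [c, weight]
  rw [hc, ofReal_integral_eq_lintegral_ofReal]
  -- The binomial coefficient vanishes for s > T, so the weight is bounded on all of ℕ.
  · refine Integrable.of_bound (Measurable.of_discrete.aestronglyMeasurable)
      (∑ s ∈ Finset.range (N + 2), weight β x s) (Filter.Eventually.of_forall fun s => ?_)
    rw [Real.norm_eq_abs, abs_of_nonneg (weight_nonneg β x s)]
    by_cases hs : s ∈ Finset.range (N + 2)
    · exact Finset.single_le_sum (f := fun s => weight β x s)
        (fun s _ => weight_nonneg β x s) hs
    · have : weight β x s = 0 := by
        rw [weight, Nat.choose_eq_zero_of_lt (by have := Finset.mem_range.not.1 hs; omega)]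
        simp
      rw [this]
      exact Finset.sum_nonneg fun s _ => weight_nonneg β x s
  · exact Filter.Eventually.of_forall fun s => weight_nonneg β x s

lemma Model.lintegral_c_zero (h : Model μ β X α ε Y) :
    ∫⁻ ω, ENNReal.ofReal (c μ β X Y 0 (X ω) * |lam (N + 2) (X ω) β|) ∂μ =
      ∫⁻ x, ENNReal.ofReal (|lam (N + 2) x β| * moment β x (condDistrib α X μ x) 1)
        ∂(μ.map X) := by
  have hX := h.measurable_X
  have hY := h.measurable_Y
  have hS : Measurable fun ω => ∑ i, Y ω i :=
    Finset.measurable_fun_sum _ fun i _ => (measurable_pi_apply i).comp hY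
  have hκ : μ.map (fun ω => (X ω, α ω)) = (μ.map X) ⊗ₘ condDistrib α X μ :=
    (compProd_map_condDistrib h.measurable_α.aemeasurable).symm
  let G : Covariates N p × ℕ → ℝ≥0∞ := fun q =>
    ENNReal.ofReal |lam (N + 2) q.1 β| * ENNReal.ofReal (weight β q.1 q.2)
  have hG : Measurable G := by
    have h1 : Measurable fun q : Covariates N p × ℕ => ENNReal.ofReal |lam (N + 2) q.1 β| :=
      ((measurable_norm.comp (measurable_lam_top β)).comp measurable_fst).ennreal_ofReal
    have h2 : Measurable fun q : Covariates N p × ℕ => ENNReal.ofReal (weight β q.1 q.2) :=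
      measurable_from_prod_countable_left fun s => (measurable_weight β s).ennreal_ofReal
    exact h1.mul h2
  have hpt : ∀ x, ENNReal.ofReal (c μ β X Y 0 x * |lam (N + 2) x β|) =
      ∫⁻ s, G (x, s) ∂(condDistrib (fun ω => ∑ i, Y ω i) X μ x) := by
    intro x
    rw [mul_comm, ENNReal.ofReal_mul (abs_nonneg _), ofReal_c_zero]
    exact (lintegral_const_mul _ Measurable.of_discrete).symm
  simp only [hpt]
  rw [← lintegral_map (f := fun x => ∫⁻ s, G (x, s) ∂(condDistrib (fun ω => ∑ i, Y ω i) X μ x))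
      hG.lintegral_kernel_prod_right' hX, ← Measure.lintegral_compProd hG,
    compProd_map_condDistrib hS.aemeasurable, lintegral_map hG (hX.prodMk hS)]
  have hg : Measurable fun q : Covariates N p × (Fin (N + 1) → ℕ) => G (q.1, ∑ i, q.2 i) := by
    refine hG.comp (measurable_fst.prodMk ?_)
    exact Finset.measurable_fun_sum _ fun i _ => (measurable_pi_apply i).comp measurable_snd
  rw [h.lintegral_eq_kernel hκ hg]
  refine lintegral_congr fun x => ?_
  simp only [G, sum_outcomePath]
  rw [ENNReal.ofReal_mul (abs_nonneg _), ← sum_weight, ENNReal.ofReal_sum_of_nonneg,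
    Finset.mul_sum]
  · refine Finset.sum_congr rfl fun A _ => ?_
    rw [responseLaw_eq, ENNReal.ofReal_mul (weight_nonneg _ _ _), mul_assoc]
  · exact fun A _ => mul_nonneg (weight_nonneg _ _ _) (mul_nonneg (Real.exp_pos _).le
      (moment_nonneg _ _ _ fun u hu => bernstein_nonneg hu))

end law

/-! ### The moment cone and its interior -/

/-- The moment curve. -/
def momentCurve (n : ℕ) (u : ℝ) : Fin n → ℝ := fun i => u ^ (i : ℕ)

/-- The coordinates of a vector in the basis `momentCurve n (y j)`, `j : Fin n`. -/
noncomputable def nodeWeights {n : ℕ} (y : Fin n → ℝ) (m : Fin n → ℝ) : Fin n → ℝ :=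
  m ᵥ* (Matrix.vandermonde y)⁻¹

lemma continuous_nodeWeights {n : ℕ} (y : Fin n → ℝ) : Continuous (nodeWeights y) := by
  unfold nodeWeights
  fun_prop

lemma sum_nodeWeights {n : ℕ} {y : Fin n → ℝ} (hy : Function.Injective y) (m : Fin n → ℝ) :
    ∑ j, nodeWeights y m j • momentCurve n (y j) = m := by
  have hdet : IsUnit (Matrix.vandermonde y).det :=
    isUnit_iff_ne_zero.2 (Matrix.det_vandermonde_ne_zero_iff.2 hy)
  have : nodeWeights y m ᵥ* Matrix.vandermonde y = m := by
    rw [nodeWeights, Matrix.vecMul_vecMul, Matrix.nonsing_inv_mul _ hdet, Matrix.vecMul_one]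
  conv_rhs => rw [← this]
  ext i
  simp [Matrix.vecMul, dotProduct, momentCurve, Finset.sum_apply, Matrix.vandermonde_apply]

lemma nodeWeights_sum {n : ℕ} {y : Fin n → ℝ} (hy : Function.Injective y) (w : Fin n → ℝ) :
    nodeWeights y (∑ j, w j • momentCurve n (y j)) = w := by
  have hdet : IsUnit (Matrix.vandermonde y).det :=
    isUnit_iff_ne_zero.2 (Matrix.det_vandermonde_ne_zero_iff.2 hy)
  have : ∑ j, w j • momentCurve n (y j) = w ᵥ* Matrix.vandermonde y := by
    ext i
    simp [Matrix.vecMul, dotProduct, momentCurve, Finset.sum_apply, Matrix.vandermonde_apply]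
  rw [this, nodeWeights, Matrix.vecMul_vecMul, Matrix.mul_nonsing_inv _ hdet, Matrix.vecMul_one]

/-- The cone spanned by the moment curve over `(0, 1)`. -/
noncomputable def momentCone (n : ℕ) : Submodule ℝ≥0 (Fin n → ℝ) :=
  Submodule.span ℝ≥0 (momentCurve n '' Set.Ioo 0 1)

lemma momentCurve_mem {n : ℕ} {u : ℝ} (hu : u ∈ Set.Ioo (0 : ℝ) 1) :
    momentCurve n u ∈ momentCone n := Submodule.subset_span ⟨u, hu, rfl⟩

lemma smul_mem_momentCone {n : ℕ} {m : Fin n → ℝ} (hm : m ∈ momentCone n) {t : ℝ} (ht : 0 ≤ t) :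
    t • m ∈ momentCone n := (momentCone n).smul_mem ⟨t, ht⟩ hm

lemma convex_momentCone (n : ℕ) : Convex ℝ (momentCone n : Set (Fin n → ℝ)) :=
  fun _ hv _ hw _ _ ha hb _ =>
    (momentCone n).add_mem (smul_mem_momentCone hv ha) (smul_mem_momentCone hw hb)

lemma mem_momentCone_of_nodeWeights {n : ℕ} {y : Fin n → ℝ} (hy : Function.Injective y)
    (hy1 : ∀ j, y j ∈ Set.Ioo (0 : ℝ) 1) {m : Fin n → ℝ} (hm : ∀ j, 0 ≤ nodeWeights y m j) :
    m ∈ momentCone n := by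
  rw [← sum_nodeWeights hy m]
  exact (momentCone n).sum_mem fun j _ => smul_mem_momentCone (momentCurve_mem (hy1 j)) (hm j)

/-- A vector of moments on which all nonzero nonnegative polynomials are positive. -/
def StrictlyPositive {n : ℕ} (m : Fin n → ℝ) : Prop :=
  ∀ c : Fin n → ℝ, c ≠ 0 → (∀ u ∈ Set.Ioo (0 : ℝ) 1, 0 ≤ ∑ i, c i * u ^ (i : ℕ)) →
    0 < ∑ i, c i * m i

lemma isOpen_nodeWeights_pos {n : ℕ} (y : Fin n → ℝ) :
    IsOpen {v : Fin n → ℝ | ∀ j, 0 < nodeWeights y v j} := by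
  simp only [Set.ofPred_forall]
  exact isOpen_iInter_of_finite fun j => isOpen_lt continuous_const
    ((continuous_apply j).comp (continuous_nodeWeights y))

/-- Otherwise a hyperplane separates m from the interior of the cone. The negated functional is a
nonzero polynomial, nonnegative on (0, 1), whose value at m is not positive. -/
lemma StrictlyPositive.mem_interior {n : ℕ} {y : Fin n → ℝ} (hy : Function.Injective y)
    (hy1 : ∀ j, y j ∈ Set.Ioo (0 : ℝ) 1) {m : Fin n → ℝ} (hm : StrictlyPositive m) :
    m ∈ interior (momentCone n : Set (Fin n → ℝ)) := by
  by_contra hmem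
  set K : Set (Fin n → ℝ) := ↑(momentCone n)
  have hconv : Convex ℝ K := convex_momentCone n
  obtain ⟨f, hf⟩ := geometric_hahn_banach_open_point hconv.interior isOpen_interior hmem
  -- Vectors with positive weights at the nodes form an open subset of the cone. Nonempty interior
  -- lets the separation extend to the whole cone and makes `f` nonzero.
  have hne : (interior K).Nonempty := by
    refine ⟨∑ j, (1 : ℝ) • momentCurve n (y j), ?_⟩
    refine interior_maximal (fun v hv => ?_) (isOpen_nodeWeights_pos y) ?_
    · exact mem_momentCone_of_nodeWeights hy hy1 fun j => (hv j).le
    · intro j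
      rw [nodeWeights_sum hy fun _ => 1]
      exact one_pos
  have hle : ∀ a ∈ K, f a ≤ f m := by
    intro a ha
    have h1 : a ∈ closure (interior K) := by
      rw [hconv.closure_interior_eq_closure_of_nonempty_interior hne]
      exact subset_closure ha
    exact closure_minimal (fun v hv => (hf v hv).le)
      (isClosed_le f.continuous continuous_const) h1
  have hfm : 0 ≤ f m := by
    have := hle 0 (momentCone n).zero_mem
    rwa [map_zero] at this
  have hneg : ∀ a ∈ K, f a ≤ 0 := by
    intro a ha
    by_contra! hpos
    -- This multiple of `a` stays in the cone and would have value f m + f a > f m.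
    have := hle ((f m / f a + 1) • a) (smul_mem_momentCone ha (by positivity))
    rw [map_smul, smul_eq_mul, add_mul, div_mul_cancel₀ _ hpos.ne'] at this
    linarith
  have hexp : ∀ v : Fin n → ℝ, ∑ i, -f (Pi.single i 1) * v i = -f v := by
    intro v
    conv_rhs => rw [pi_eq_sum_univ' v]
    simp [mul_comm]
  have hc : (fun i => -f (Pi.single i 1)) ≠ 0 := by
    intro h0
    obtain ⟨a, ha⟩ := hne
    have h1 : ∀ v, f v = 0 := by
      intro v
      have h2 := hexp v
      have h3 : ∀ i, -f (Pi.single i 1) = 0 := fun i => congrFun h0 i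
      simp only [h3, zero_mul, Finset.sum_const_zero] at h2
      linarith
    have := hf a ha
    rw [h1, h1] at this
    exact lt_irrefl _ this
  have := hm _ hc fun u hu => by
    have h1 : ∑ i : Fin n, -f (Pi.single i 1) * u ^ (i : ℕ) = -f (momentCurve n u) :=
      hexp (momentCurve n u)
    have h2 := hneg _ (momentCurve_mem hu)
    rw [h1]
    linarith
  rw [hexp] at this
  linarith

/-- Countably many discrete measures suffice to complete strictly positive moment vectors by
nonnegative weights at the nodes. -/
lemma exists_countable_completion {n : ℕ} {y : Fin n → ℝ} (hy : Function.Injective y)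
    (hy1 : ∀ j, y j ∈ Set.Ioo (0 : ℝ) 1) (z : ℝ) :
    ∃ l : ℕ → (ℝ →₀ ℝ≥0), (∀ i, ∀ u ∈ (l i).support, u ∈ Set.Ioo (0 : ℝ) 1) ∧
      ∀ m : Fin n → ℝ, StrictlyPositive m → ∃ i r : ℕ, ∀ j,
        0 ≤ nodeWeights y (m - ∑ u ∈ (l i).support, (l i u : ℝ) • momentCurve n u) j ∧
        0 ≤ nodeWeights y (m - ∑ u ∈ (l i).support, (l i u : ℝ) • momentCurve n u -
          ((r : ℝ) + 1)⁻¹ • momentCurve n z) j := by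
  have hrep : ∀ a : momentCone n, ∃ l : ℝ →₀ ℝ≥0, (∀ u ∈ l.support, u ∈ Set.Ioo (0 : ℝ) 1) ∧
      ∑ u ∈ l.support, (l u : ℝ) • momentCurve n u = a := by
    rintro ⟨a, ha⟩
    obtain ⟨l, hl, rfl⟩ := (Finsupp.mem_span_image_iff_linearCombination _).1 ha
    exact ⟨l, fun u hu => hl hu, rfl⟩
  choose rep hrep1 hrep2 using hrep
  refine ⟨fun i => rep (TopologicalSpace.denseSeq (momentCone n) i), fun i => hrep1 _,
    fun m hm => ?_⟩
  simp only [hrep2]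
  set g := ∑ j, (1 : ℝ) • momentCurve n (y j) with hg
  have hint := hm.mem_interior hy hy1
  -- Being interior, m can lose mass t at every node and stay in the cone. The difference between m
  -- and that cone point has all node weights equal to t > 0; this open condition passes to a nearby
  -- point of the dense sequence.
  obtain ⟨t, ht, htm⟩ : ∃ t : ℝ, 0 < t ∧ m - t • g ∈ momentCone n := by
    have hc : Filter.Tendsto (fun t : ℝ => m - t • g) (nhdsWithin 0 (Set.Ioi 0)) (nhds m) := by
      have : Continuous fun t : ℝ => m - t • g := by fun_prop
      have h := this.tendsto 0
      simp only [zero_smul, sub_zero] at h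
      exact h.mono_left nhdsWithin_le_nhds
    have h1 := hc.eventually (mem_interior_iff_mem_nhds.1 hint)
    obtain ⟨t, h2, h3⟩ := (h1.and self_mem_nhdsWithin).exists
    exact ⟨t, h3, h2⟩
  have hW : IsOpen {a : momentCone n | ∀ j, 0 < nodeWeights y (m - (a : Fin n → ℝ)) j} :=
    (isOpen_nodeWeights_pos y).preimage (by fun_prop : Continuous
      fun a : momentCone n => m - (a : Fin n → ℝ))
  obtain ⟨i, hi⟩ := (TopologicalSpace.denseRange_denseSeq (momentCone n)).exists_mem_open hW
    ⟨⟨m - t • g, htm⟩, fun j => by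
      simp only [sub_sub_cancel]
      rw [hg, Finset.smul_sum]
      simp only [smul_smul]
      rw [nodeWeights_sum hy fun _ => t * 1]
      simpa using ht⟩
  set d : Fin n → ℝ := ↑(TopologicalSpace.denseSeq (momentCone n) i)
  -- Positivity of the node weights also survives setting aside a small enough mass at `z`.
  have hlim : Filter.Tendsto (fun r : ℕ => m - d - ((r : ℝ) + 1)⁻¹ • momentCurve n z)
      Filter.atTop (nhds (m - d)) := by
    have h0 : Filter.Tendsto (fun r : ℕ => ((r : ℝ) + 1)⁻¹) Filter.atTop (nhds 0) := by
      simpa using tendsto_one_div_add_atTop_nhds_zero_nat (𝕜 := ℝ)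
    simpa using (h0.smul_const (momentCurve n z)).const_sub (m - d)
  obtain ⟨r, hr⟩ := (hlim.eventually ((isOpen_nodeWeights_pos y).mem_nhds hi)).exists
  exact ⟨i, r, fun j => ⟨(hi j).le, (hr j).le⟩⟩

/-! ### Atomic conditional laws with prescribed moments -/

/-- The law of `α` given `X = x` with atoms where `Λ(x_T'β + α)` takes the values `Λ(b i)`; the
weights `w i` are the masses divided by `∏_{t < T} (u (exp((x_t - x_T)'β) - 1) + 1)`. -/
noncomputable def atomicLaw {ι : Type*} [Fintype ι] (β : Fin p → ℝ) (b : ι → ℝ) (w : ι → ℝ)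
    (x : Covariates N p) : Measure ℝ :=
  ∑ i, ENNReal.ofReal (w i * (ratioPolynomial x β).eval (Real.sigmoid (b i))) •
    Measure.dirac (b i - x (Fin.last N) ⬝ᵥ β)

instance {ι : Type*} [Fintype ι] (β : Fin p → ℝ) (b : ι → ℝ) (w : ι → ℝ)
    (x : Covariates N p) : IsFiniteMeasure (atomicLaw β b w x) := by
  constructor
  simp [atomicLaw, ENNReal.sum_lt_top]

lemma moment_atomicLaw {ι : Type*} [Fintype ι] (β : Fin p → ℝ) (b : ι → ℝ) {w : ι → ℝ}
    (hw : ∀ i, 0 ≤ w i) (x : Covariates N p) (q : Polynomial ℝ) :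
    moment β x (atomicLaw β b w x) q = ∑ i, w i * q.eval (Real.sigmoid (b i)) := by
  rw [moment_apply, atomicLaw, integral_finsetSum_measure]
  · refine Finset.sum_congr rfl fun i _ => ?_
    have hD := eval_ratioPolynomial_pos x β (sigmoid_mem_Icc (b i))
    rw [integral_smul_measure, integral_dirac, add_sub_cancel, ENNReal.toReal_ofReal
      (mul_nonneg (hw i) hD.le), smul_eq_mul]
    field_simp
  · intro i _
    exact (integrable_moment β x (Measure.dirac (b i - x (Fin.last N) ⬝ᵥ β)) q).smul_measure
      ENNReal.ofReal_ne_top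

lemma moment_ratioPolynomial (β : Fin p → ℝ) (x : Covariates N p) (ν : Measure ℝ)
    [IsFiniteMeasure ν] : moment β x ν (ratioPolynomial x β) = ν.real Set.univ := by
  have h : ∀ a, (ratioPolynomial x β).eval (Real.sigmoid (x (Fin.last N) ⬝ᵥ β + a)) /
      (ratioPolynomial x β).eval (Real.sigmoid (x (Fin.last N) ⬝ᵥ β + a)) = 1 := fun a =>
    div_self (eval_ratioPolynomial_pos x β (sigmoid_mem_Icc _)).ne'
  simp [moment_apply, h]

lemma moment_atomicLaw_eq {ι : Type*} [Fintype ι] {β : Fin p → ℝ} {b : ι → ℝ} {w : ι → ℝ}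
    (hw : ∀ i, 0 ≤ w i) {x : Covariates N p} {ν : Measure ℝ} [IsFiniteMeasure ν]
    (h : ∀ j < N + 2, ∑ i, w i * Real.sigmoid (b i) ^ j = moment β x ν (Polynomial.X ^ j))
    {q : Polynomial ℝ} (hq : q.natDegree ≤ N + 1) :
    moment β x (atomicLaw β b w x) q = moment β x ν q := by
  have hX : ∀ j < N + 2, moment β x (atomicLaw β b w x) (Polynomial.X ^ j) =
      moment β x ν (Polynomial.X ^ j) := by
    intro j hj
    rw [moment_atomicLaw β b hw, ← h j hj]
    simp
  rw [q.as_sum_range_C_mul_X_pow]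
  simp only [map_sum, ← Polynomial.smul_eq_C_mul, map_smul]
  refine Finset.sum_congr rfl fun j hj => ?_
  rw [hX j (by have := Finset.mem_range.1 hj; omega)]

/-- The total mass is the moment of D, whose degree is at most T - 1, so matching the moments up to
order T already normalizes the law. -/
lemma isProbabilityMeasure_atomicLaw {ι : Type*} [Fintype ι] {β : Fin p → ℝ} {b : ι → ℝ}
    {w : ι → ℝ} (hw : ∀ i, 0 ≤ w i) {x : Covariates N p} {ν : Measure ℝ} [IsProbabilityMeasure ν]
    (h : ∀ j < N + 2, ∑ i, w i * Real.sigmoid (b i) ^ j = moment β x ν (Polynomial.X ^ j)) :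
    IsProbabilityMeasure (atomicLaw β b w x) := by
  have h1 := moment_atomicLaw_eq hw h
    ((natDegree_ratioPolynomial_le x β).trans (Nat.le_succ N))
  rw [moment_ratioPolynomial, moment_ratioPolynomial, probReal_univ (μ := ν)] at h1
  exact ⟨(ENNReal.toReal_eq_one_iff _).1 h1⟩

lemma measurable_eval_ratioPolynomial (β : Fin p → ℝ) (u : ℝ) :
    Measurable fun x : Covariates N p => (ratioPolynomial x β).eval u := by
  have h := measurable_dotProduct_const (N := N) β
  simp only [eval_ratioPolynomial, sub_dotProduct]
  refine Finset.measurable_fun_prod _ fun t _ => ?_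
  exact ((((h _).sub (h _)).exp.sub_const 1).const_mul u).add_const 1

lemma measurable_atomicLaw {ι : Type*} [Fintype ι] (β : Fin p → ℝ) (b : ι → ℝ)
    {w : Covariates N p → ι → ℝ} (hw : Measurable w) :
    Measurable fun x => atomicLaw β b (w x) x := by
  refine Measure.measurable_of_measurable_coe _ fun s hs => ?_
  simp only [atomicLaw, Measure.coe_finsetSum, Finset.sum_apply, Measure.smul_apply, smul_eq_mul,
    Measure.dirac_apply' _ hs]
  refine Finset.measurable_fun_sum _ fun i _ => Measurable.mul ?_ ?_
  · exact (((measurable_pi_apply i).comp hw).mul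
      (measurable_eval_ratioPolynomial β _)).ennreal_ofReal
  · exact (measurable_one.indicator hs).comp
      ((measurable_dotProduct_const β (Fin.last N)).const_sub (b i))

/-- Replacing the conditional law of `α` on a set of covariate paths by an atomic one with the same
moments. -/
lemma exists_kernel_atomicLaw {ι : Type*} [Fintype ι] (β : Fin p → ℝ) (b : ι → ℝ)
    {w : Covariates N p → ι → ℝ} (hw : Measurable w) (κ : Kernel (Covariates N p) ℝ)
    [IsMarkovKernel κ] {B : Set (Covariates N p)} (hB : MeasurableSet B)
    (hw0 : ∀ x ∈ B, ∀ i, 0 ≤ w x i)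
    (hmom : ∀ x ∈ B, ∀ j < N + 2,
      ∑ i, w x i * Real.sigmoid (b i) ^ j = moment β x (κ x) (Polynomial.X ^ j)) :
    ∃ κ' : Kernel (Covariates N p) ℝ, IsMarkovKernel κ' ∧
      (∀ x A, responseLaw β x (κ' x) A = responseLaw β x (κ x) A) ∧
      (∀ x ∈ B, κ' x = atomicLaw β b (w x) x) ∧ ∀ x ∉ B, κ' x = κ x := by
  classical
  let κ' : Kernel (Covariates N p) ℝ :=
    { toFun := fun x => if x ∈ B then atomicLaw β b (w x) x else κ x
      measurable' := Measurable.ite hB (measurable_atomicLaw β b hw) κ.measurable }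
  have hin : ∀ x ∈ B, κ' x = atomicLaw β b (w x) x := fun x hx => if_pos hx
  have hout : ∀ x ∉ B, κ' x = κ x := fun x hx => if_neg hx
  refine ⟨κ', ⟨fun x => ?_⟩, fun x A => ?_, hin, hout⟩
  · by_cases hx : x ∈ B
    · rw [hin x hx]
      exact isProbabilityMeasure_atomicLaw (hw0 x hx) (hmom x hx)
    · rw [hout x hx]
      infer_instance
  · by_cases hx : x ∈ B
    · rw [hin x hx]
      exact responseLaw_eq_of_moment_eq
        (fun q hq => moment_atomicLaw_eq (hw0 x hx) (hmom x hx) hq) A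
    · rw [hout x hx]

lemma measurable_moment (β : Fin p → ℝ) (κ : Kernel (Covariates N p) ℝ) [IsFiniteKernel κ]
    (j : ℕ) : Measurable fun x => moment β x (κ x) (Polynomial.X ^ j) := by
  have hu : Measurable fun q : Covariates N p × ℝ =>
      Real.sigmoid (q.1 (Fin.last N) ⬝ᵥ β + q.2) :=
    measurable_sigmoid.comp (measurable_index β (Fin.last N))
  have hD : Measurable fun q : Covariates N p × ℝ =>
      (ratioPolynomial q.1 β).eval (Real.sigmoid (q.1 (Fin.last N) ⬝ᵥ β + q.2)) := by
    have h := measurable_dotProduct_const (N := N) β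
    simp only [eval_ratioPolynomial, sub_dotProduct]
    refine Finset.measurable_fun_prod _ fun t _ => ?_
    exact (hu.mul ((((h _).comp measurable_fst).sub
      ((h _).comp measurable_fst)).exp.sub_const 1)).add_const 1
  simp only [moment_apply, Polynomial.eval_pow, Polynomial.eval_X]
  exact (StronglyMeasurable.integral_kernel_prod_right' (κ := κ)
    (f := fun q : Covariates N p × ℝ => Real.sigmoid (q.1 (Fin.last N) ⬝ᵥ β + q.2) ^ j /
      (ratioPolynomial q.1 β).eval (Real.sigmoid (q.1 (Fin.last N) ⬝ᵥ β + q.2)))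
    ((hu.pow_const j).div hD).stronglyMeasurable).measurable

lemma norm_effect_le (β : Fin p → ℝ) (x : Covariates N p) (ν : Measure ℝ)
    [IsProbabilityMeasure ν] : ‖effect β x ν‖ ≤ 1 := by
  refine (norm_integral_le_of_norm_le_const (C := 1)
    (Filter.Eventually.of_forall fun a => ?_)).trans (by simp)
  have h0 := Real.sigmoid_pos (x (Fin.last N) ⬝ᵥ β + a)
  have h1 := Real.sigmoid_lt_one (x (Fin.last N) ⬝ᵥ β + a)
  rw [Real.norm_eq_abs, abs_le]
  constructor <;> nlinarith

lemma measurable_effect (β : Fin p → ℝ) (κ : Kernel (Covariates N p) ℝ) [IsSFiniteKernel κ] :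
    Measurable fun x => effect β x (κ x) := by
  have hu : Measurable fun q : Covariates N p × ℝ =>
      Real.sigmoid (q.1 (Fin.last N) ⬝ᵥ β + q.2) :=
    measurable_sigmoid.comp (measurable_index β (Fin.last N))
  exact (StronglyMeasurable.integral_kernel_prod_right' (κ := κ)
    (f := fun q : Covariates N p × ℝ => Real.sigmoid (q.1 (Fin.last N) ⬝ᵥ β + q.2) *
      (1 - Real.sigmoid (q.1 (Fin.last N) ⬝ᵥ β + q.2)))
    (hu.mul (hu.const_sub 1)).stronglyMeasurable).measurable

lemma integrable_effect (β : Fin p → ℝ) (κ : Kernel (Covariates N p) ℝ) [IsMarkovKernel κ]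
    (ξ : Measure (Covariates N p)) [IsFiniteMeasure ξ] :
    Integrable (fun x => effect β x (κ x)) ξ :=
  Integrable.of_bound (measurable_effect β κ).aestronglyMeasurable 1
    (Filter.Eventually.of_forall fun x => norm_effect_le β x (κ x))

/-! ### Measurable completions and necessity of the condition -/

lemma exists_logit : ∃ g : ℝ → ℝ, ∀ u ∈ Set.Ioo (0 : ℝ) 1, Real.sigmoid (g u) = u := by
  have h : ∀ u : ℝ, ∃ b, u ∈ Set.Ioo (0 : ℝ) 1 → Real.sigmoid b = u := by
    intro u
    by_cases hu : u ∈ Set.Ioo (0 : ℝ) 1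
    · rw [← Real.range_sigmoid] at hu
      obtain ⟨b, hb⟩ := hu
      exact ⟨b, fun _ => hb⟩
    · exact ⟨0, fun h => absurd h hu⟩
  choose g hg using h
  exact ⟨g, hg⟩

lemma exists_nodes (n : ℕ) : ∃ (y : Fin n → ℝ) (z : ℝ), Function.Injective y ∧
    (∀ j, y j ∈ Set.Ioo (0 : ℝ) 1) ∧ z ∈ Set.Ioo (0 : ℝ) 1 ∧ ∀ j, z ≠ y j := by
  have hn : (0 : ℝ) < (n : ℝ) + 2 := by positivity
  refine ⟨fun j => ((j : ℕ) + 1) / ((n : ℝ) + 2), (n + 1) / ((n : ℝ) + 2), ?_, fun j => ?_, ?_,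
    fun j => ?_⟩
  · intro i j hij
    have : ((i : ℕ) : ℝ) + 1 = (j : ℕ) + 1 := by simpa [div_left_inj' hn.ne'] using hij
    exact Fin.ext (by exact_mod_cast add_right_cancel this)
  · have hj : ((j : ℕ) : ℝ) < n := by exact_mod_cast j.2
    exact ⟨by positivity, by rw [div_lt_one hn]; linarith⟩
  · exact ⟨by positivity, by rw [div_lt_one hn]; linarith⟩
  · have hj : ((j : ℕ) : ℝ) < n := by exact_mod_cast j.2
    rw [Ne, div_left_inj' hn.ne']
    intro h
    linarith

/-- The first moments of the law of `Λ(x_T'β + α)` given `X = x`, up to the change of density. -/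
noncomputable def momentVector (β : Fin p → ℝ) (κ : Kernel (Covariates N p) ℝ) [IsFiniteKernel κ]
    (x : Covariates N p) : Fin (N + 2) → ℝ :=
  fun j => moment β x (κ x) (Polynomial.X ^ (j : ℕ))

lemma measurable_momentVector (β : Fin p → ℝ) (κ : Kernel (Covariates N p) ℝ) [IsFiniteKernel κ] :
    Measurable (momentVector β κ) :=
  measurable_pi_lambda _ fun j => measurable_moment β κ j

/-- The polynomial that vanishes at the nodes. -/
noncomputable def nodePolynomial {n : ℕ} (y : Fin n → ℝ) : Polynomial ℝ :=
  ∏ j, (Polynomial.X - Polynomial.C (y j))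

lemma monic_nodePolynomial {n : ℕ} (y : Fin n → ℝ) : (nodePolynomial y).Monic :=
  Polynomial.monic_prod_of_monic _ _ fun _ _ => Polynomial.monic_X_sub_C _

lemma natDegree_nodePolynomial {n : ℕ} (y : Fin n → ℝ) : (nodePolynomial y).natDegree = n := by
  rw [nodePolynomial, Polynomial.natDegree_prod_of_monic _ _ fun _ _ => Polynomial.monic_X_sub_C _]
  simp

lemma eval_nodePolynomial {n : ℕ} (y : Fin n → ℝ) (u : ℝ) :
    (nodePolynomial y).eval u = ∏ j, (u - y j) := by
  simp [nodePolynomial, Polynomial.eval_prod]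

/-- With the atoms of `l` and the mass θ at `z` prescribed, the node weights solve a Vandermonde
system, so they are linear in the moment vector and measurable in x. Comparing effects through the
polynomial that vanishes at the nodes makes these weights drop out. -/
lemma exists_completed_kernel (β : Fin p → ℝ) (κ : Kernel (Covariates N p) ℝ) [IsMarkovKernel κ]
    {y : Fin (N + 2) → ℝ} (hy : Function.Injective y) (hy1 : ∀ j, y j ∈ Set.Ioo (0 : ℝ) 1)
    {z : ℝ} (hz : z ∈ Set.Ioo (0 : ℝ) 1) {l : ℝ →₀ ℝ≥0}
    (hl : ∀ u ∈ l.support, u ∈ Set.Ioo (0 : ℝ) 1) {θ : ℝ} (hθ : 0 ≤ θ)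
    {B : Set (Covariates N p)} (hB : MeasurableSet B)
    (hpos : ∀ x ∈ B, ∀ j, 0 ≤ nodeWeights y (momentVector β κ x -
      ∑ u ∈ l.support, (l u : ℝ) • momentCurve (N + 2) u - θ • momentCurve (N + 2) z) j) :
    ∃ κ' : Kernel (Covariates N p) ℝ, IsMarkovKernel κ' ∧
      (∀ x A, responseLaw β x (κ' x) A = responseLaw β x (κ x) A) ∧
      (∀ x ∈ B, effect β x (κ' x) - effect β x (κ x) = lam (N + 2) x β *
        (∑ u ∈ l.support, l u * (nodePolynomial y).eval u + θ * (nodePolynomial y).eval z -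
          moment β x (κ x) (nodePolynomial y))) ∧
      ∀ x ∉ B, effect β x (κ' x) = effect β x (κ x) := by
  obtain ⟨g, hg⟩ := exists_logit
  let W : Covariates N p → Fin (N + 2) → ℝ := fun x => nodeWeights y (momentVector β κ x -
      ∑ u ∈ l.support, (l u : ℝ) • momentCurve (N + 2) u - θ • momentCurve (N + 2) z)
  let b : l.support ⊕ Fin (N + 2) ⊕ Unit → ℝ :=
    Sum.elim (fun u => g u) (Sum.elim (fun j => g (y j)) fun _ => g z)
  let w : Covariates N p → l.support ⊕ Fin (N + 2) ⊕ Unit → ℝ := fun x =>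
    Sum.elim (fun u => l u) (Sum.elim (W x) fun _ => θ)
  have hW : Measurable W := (continuous_nodeWeights y).measurable.comp
    (((measurable_momentVector β κ).sub_const _).sub_const _)
  have hw : Measurable w := by
    refine measurable_pi_lambda _ fun i => ?_
    rcases i with u | j | _
    · exact measurable_const
    · exact (measurable_pi_apply j).comp hW
    · exact measurable_const
  have hw0 : ∀ x ∈ B, ∀ i, 0 ≤ w x i := by
    intro x hx i
    rcases i with u | j | _
    · exact (l u).2
    · exact hpos x hx j
    · exact hθ
  have hsum : ∀ x (f : ℝ → ℝ), ∑ i, w x i * f (Real.sigmoid (b i)) =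
      ∑ u ∈ l.support, l u * f u + (∑ j, W x j * f (y j) + θ * f z) := by
    intro x f
    rw [Fintype.sum_sum_type, Fintype.sum_sum_type]
    congr 1
    · rw [← Finset.sum_coe_sort l.support fun u => (l u : ℝ) * f u]
      refine Finset.sum_congr rfl fun u _ => ?_
      simp only [w, b, Sum.elim_inl, hg _ (hl u u.2)]
    · congr 1
      · refine Finset.sum_congr rfl fun j _ => ?_
        simp only [w, b, Sum.elim_inl, Sum.elim_inr, hg _ (hy1 j)]
      · simp only [w, b, Sum.elim_inr, hg _ hz, Finset.univ_unique, Finset.sum_singleton]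
  have hmom : ∀ x ∈ B, ∀ j < N + 2,
      ∑ i, w x i * Real.sigmoid (b i) ^ j = moment β x (κ x) (Polynomial.X ^ j) := by
    intro x _ j hj
    rw [hsum x fun u => u ^ j]
    have h := congrFun (sum_nodeWeights hy (momentVector β κ x -
      ∑ u ∈ l.support, (l u : ℝ) • momentCurve (N + 2) u - θ • momentCurve (N + 2) z)) ⟨j, hj⟩
    simp only [Finset.sum_apply, Pi.smul_apply, Pi.sub_apply, smul_eq_mul, momentCurve,
      momentVector] at h
    linarith
  obtain ⟨κ', hκ', hlaw, hin, hout⟩ := exists_kernel_atomicLaw β b hw κ hB hw0 hmom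
  refine ⟨κ', hκ', hlaw, fun x hx => ?_, fun x hx => by rw [hout x hx]⟩
  rw [effect_sub_effect (hlaw x) (monic_nodePolynomial y) (natDegree_nodePolynomial y)]
  have h1 : moment β x (κ' x) (nodePolynomial y) =
      moment β x (atomicLaw β b (w x) x) (nodePolynomial y) := by
    simp only [moment_apply, hin x hx]
  have h2 : ∑ j, W x j * (nodePolynomial y).eval (y j) = 0 := by
    refine Finset.sum_eq_zero fun j _ => ?_
    rw [eval_nodePolynomial, Finset.prod_eq_zero (Finset.mem_univ j) (sub_self _), mul_zero]
  rw [h1, moment_atomicLaw β b (hw0 x hx), hsum x fun u => (nodePolynomial y).eval u, h2, zero_add]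

lemma strictlyPositive_momentVector (β : Fin p → ℝ) (κ : Kernel (Covariates N p) ℝ)
    [IsMarkovKernel κ] {x : Covariates N p}
    (hx : ¬ 2 * (κ x).support.encard ≤ ((N + 1 : ℕ) : ℕ∞)) :
    StrictlyPositive (momentVector β κ x) := by
  intro c hc hnn
  let q : Polynomial ℝ := ∑ i : Fin (N + 2), Polynomial.C (c i) * Polynomial.X ^ (i : ℕ)
  have hcoeff : ∀ i : Fin (N + 2), q.coeff i = c i := by
    intro i
    simp only [q, Polynomial.finsetSum_coeff, Polynomial.coeff_C_mul_X_pow]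
    rw [Finset.sum_eq_single i]
    · simp
    · intro j _ hj
      rw [if_neg fun h => hj (Fin.ext h.symm)]
    · simp
  have hq0 : q ≠ 0 := by
    rintro hq
    exact hc (funext fun i => by rw [← hcoeff i, hq]; simp)
  have hdeg : q.natDegree ≤ N + 1 := Polynomial.natDegree_sum_le_of_forall_le _ _ fun i _ =>
    (Polynomial.natDegree_C_mul_X_pow_le _ _).trans (by omega)
  have := moment_pos (β := β) (x := x) hx hq0 hdeg fun u hu => by
    simpa [q, Polynomial.eval_finsetSum] using hnn u hu
  simpa [q, ← Polynomial.smul_eq_C_mul, momentVector] using this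

/-- If no conditional law with the same observable implications changes the mean effect, then almost
surely the top coefficient vanishes or the support is small. -/
lemma ae_of_integral_effect_eq (β : Fin p → ℝ) (ξ : Measure (Covariates N p))
    [IsProbabilityMeasure ξ] (κ : Kernel (Covariates N p) ℝ) [IsMarkovKernel κ] {e : ℝ}
    (h : ∀ κ' : Kernel (Covariates N p) ℝ, IsMarkovKernel κ' →
      (∀ x A, responseLaw β x (κ' x) A = responseLaw β x (κ x) A) →
        ∫ x, effect β x (κ' x) ∂ξ = e) :
    ∀ᵐ x ∂ξ, lam (N + 2) x β = 0 ∨ 2 * (κ x).support.encard ≤ ((N + 1 : ℕ) : ℕ∞) := by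
  obtain ⟨y, z, hy, hy1, hz, hzy⟩ := exists_nodes (N + 2)
  obtain ⟨l, hl, hcover⟩ := exists_countable_completion hy hy1 z
  have hQ : (nodePolynomial y).eval z ≠ 0 := by
    rw [eval_nodePolynomial]
    exact Finset.prod_ne_zero_iff.2 fun j _ => sub_ne_zero.2 (hzy j)
  let B₀ : ℕ → ℕ → Set (Covariates N p) := fun i r => {x | ∀ j,
    0 ≤ nodeWeights y (momentVector β κ x -
      ∑ u ∈ (l i).support, (l i u : ℝ) • momentCurve (N + 2) u) j ∧
    0 ≤ nodeWeights y (momentVector β κ x -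
      ∑ u ∈ (l i).support, (l i u : ℝ) • momentCurve (N + 2) u -
        ((r : ℝ) + 1)⁻¹ • momentCurve (N + 2) z) j}
  have hB₀ : ∀ i r, MeasurableSet (B₀ i r) := by
    intro i r
    have hm := measurable_momentVector β κ
    have hn : ∀ (v : Fin (N + 2) → ℝ) (j : Fin (N + 2)),
        Measurable fun x => nodeWeights y (momentVector β κ x - v) j := fun v j =>
      (measurable_pi_apply j).comp ((continuous_nodeWeights y).measurable.comp (hm.sub_const v))
    simp only [B₀, Set.ofPred_forall, sub_sub]
    refine MeasurableSet.iInter fun j => ?_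
    exact (measurableSet_le measurable_const (hn _ j)).inter
      (measurableSet_le measurable_const (hn _ j))
  -- Fixing the sign of λ_{T+1}, through s = 1 or s = -1, rules out cancellation: a zero integral
  -- over the set then makes it null.
  have hnull : ∀ i r, ∀ s : ℝ, ξ (B₀ i r ∩ {x | 0 < s * lam (N + 2) x β}) = 0 := by
    intro i r s
    set B := B₀ i r ∩ {x | 0 < s * lam (N + 2) x β}
    have hB : MeasurableSet B := (hB₀ i r).inter
      (measurableSet_lt measurable_const ((measurable_lam_top β).const_mul s))
    have hθ : (0 : ℝ) < ((r : ℝ) + 1)⁻¹ := by positivity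
    -- Two completions are compared with each other, not with κ, whose own moment of order T + 1 is
    -- not controlled. They differ only by the mass at `z` and the induced node weights.
    obtain ⟨κ₀, hκ₀, hlaw₀, hin₀, hout₀⟩ := exists_completed_kernel β κ hy hy1 hz (hl i)
      (le_refl (0 : ℝ)) hB fun x hx j => by
        rw [zero_smul, sub_zero]
        exact (hx.1 j).1
    obtain ⟨κ₁, hκ₁, hlaw₁, hin₁, hout₁⟩ := exists_completed_kernel β κ hy hy1 hz (hl i)
      hθ.le hB fun x hx j => (hx.1 j).2
    have hdiff : ∀ x, effect β x (κ₁ x) - effect β x (κ₀ x) =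
        B.indicator (fun x => lam (N + 2) x β) x *
          (((r : ℝ) + 1)⁻¹ * (nodePolynomial y).eval z) := by
      intro x
      by_cases hx : x ∈ B
      · rw [Set.indicator_of_mem hx, ← sub_sub_sub_cancel_right _ _ (effect β x (κ x)), hin₀ x hx,
          hin₁ x hx]
        ring
      · rw [Set.indicator_of_notMem hx, hout₀ x hx, hout₁ x hx, sub_self, zero_mul]
    have hint := (integrable_effect β κ₁ ξ).sub (integrable_effect β κ₀ ξ)
    have hzero : ∫ x, (effect β x (κ₁ x) - effect β x (κ₀ x)) ∂ξ = 0 := by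
      rw [integral_sub (integrable_effect β κ₁ ξ) (integrable_effect β κ₀ ξ), h κ₁ hκ₁ hlaw₁,
        h κ₀ hκ₀ hlaw₀, sub_self]
    have hc : ((r : ℝ) + 1)⁻¹ * (nodePolynomial y).eval z ≠ 0 := mul_ne_zero hθ.ne' hQ
    simp only [hdiff] at hzero
    rw [integral_mul_const, mul_eq_zero, or_iff_left hc] at hzero
    -- λ_{T+1} need not be integrable in general; on this set it is a constant multiple of a
    -- difference of bounded effects.
    have hint' : Integrable (B.indicator fun x => lam (N + 2) x β) ξ := by
      have h1 : Integrable (fun x => B.indicator (fun x => lam (N + 2) x β) x *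
          (((r : ℝ) + 1)⁻¹ * (nodePolynomial y).eval z)) ξ := by
        refine hint.congr (Filter.Eventually.of_forall fun x => ?_)
        exact hdiff x
      exact (integrable_mul_const_iff (isUnit_iff_ne_zero.2 hc) _).1 h1
    have hnn : 0 ≤ fun x => s * B.indicator (fun x => lam (N + 2) x β) x := by
      intro x
      by_cases hx : x ∈ B
      · simp only [Set.indicator_of_mem hx]
        exact hx.2.le
      · simp [Set.indicator_of_notMem hx]
    have h2 : ∫ x, s * B.indicator (fun x => lam (N + 2) x β) x ∂ξ = 0 := by
      rw [integral_const_mul, hzero, mul_zero]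
    rw [integral_eq_zero_iff_of_nonneg hnn (hint'.const_mul s)] at h2
    refine measure_mono_null (fun x hx => ?_) h2
    simp only [Set.mem_compl_iff, Set.mem_ofPred_eq, Set.indicator_of_mem hx, Pi.zero_apply]
    exact hx.2.ne'
  have hae : ∀ᵐ x ∂ξ, ∀ i r, x ∉ B₀ i r ∩ {x | 0 < (1 : ℝ) * lam (N + 2) x β} ∧
      x ∉ B₀ i r ∩ {x | 0 < (-1 : ℝ) * lam (N + 2) x β} :=
    ae_all_iff.2 fun i => ae_all_iff.2 fun r =>
      (measure_eq_zero_iff_ae_notMem.1 (hnull i r 1)).and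
        (measure_eq_zero_iff_ae_notMem.1 (hnull i r (-1)))
  filter_upwards [hae] with x hx
  by_contra! hcon
  obtain ⟨hlam, hsupp⟩ := hcon
  obtain ⟨i, r, hir⟩ := hcover _ (strictlyPositive_momentVector β κ hsupp.not_ge)
  rcases lt_or_gt_of_ne hlam with hneg | hpos
  · exact (hx i r).2 ⟨hir, by simpa using hneg⟩
  · exact (hx i r).1 ⟨hir, by simpa using hpos⟩

/-! ### The identified interval and point identification -/

lemma responseLaw_mixture (β : Fin p → ℝ) (x : Covariates N p) (ν ν' : Measure ℝ) (a b : ℝ≥0∞)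
    (A : Finset (Fin (N + 1))) :
    responseLaw β x (a • ν + b • ν') A = a * responseLaw β x ν A + b * responseLaw β x ν' A := by
  simp only [responseLaw, lintegral_add_measure, lintegral_smul_measure, smul_eq_mul]

lemma integrable_effect_integrand (β : Fin p → ℝ) (x : Covariates N p) (ν : Measure ℝ)
    [IsFiniteMeasure ν] :
    Integrable (fun a => Real.sigmoid (x (Fin.last N) ⬝ᵥ β + a) *
      (1 - Real.sigmoid (x (Fin.last N) ⬝ᵥ β + a))) ν := by
  refine Integrable.of_bound (by fun_prop) 1 (Filter.Eventually.of_forall fun a => ?_)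
  have h0 := Real.sigmoid_pos (x (Fin.last N) ⬝ᵥ β + a)
  have h1 := Real.sigmoid_lt_one (x (Fin.last N) ⬝ᵥ β + a)
  rw [Real.norm_eq_abs, abs_le]
  constructor <;> nlinarith

lemma effect_mixture (β : Fin p → ℝ) (x : Covariates N p) (ν ν' : Measure ℝ) [IsFiniteMeasure ν]
    [IsFiniteMeasure ν'] {a b : ℝ} (ha : 0 ≤ a) (hb : 0 ≤ b) :
    effect β x (ENNReal.ofReal a • ν + ENNReal.ofReal b • ν') =
      a * effect β x ν + b * effect β x ν' := by
  rw [effect, integral_add_measure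
    ((integrable_effect_integrand β x ν).smul_measure ENNReal.ofReal_ne_top)
    ((integrable_effect_integrand β x ν').smul_measure ENNReal.ofReal_ne_top),
    integral_smul_measure, integral_smul_measure, ENNReal.toReal_ofReal ha,
    ENNReal.toReal_ofReal hb]
  rfl

section model

variable {Ω : Type*} [MeasurableSpace Ω] {μ : Measure Ω} [IsProbabilityMeasure μ]
  {β : Fin p → ℝ} {X : Ω → Covariates N p} {α : Ω → ℝ} {ε : Ω → Fin (N + 1) → ℝ}
  {Y : Ω → Fin (N + 1) → ℕ}

lemma Model.averageMarginalEffect_mem (h : Model μ β X α ε Y) (hvary : VaryingCovariates μ X)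
    (k : Fin p) :
    averageMarginalEffect μ k β X α ∈ rationalizedEffects k (μ.map fun ω => (X ω, Y ω)) :=
  (mem_rationalizedEffects_iff h hvary k _).2 ⟨condDistrib α X μ, inferInstance,
    Filter.Eventually.of_forall fun _ _ => rfl, (h.averageMarginalEffect_eq
      (compProd_map_condDistrib h.measurable_α.aemeasurable).symm k).symm⟩

/-- All rationalizing structures share the same slope, so one may mix the conditional laws of α, in
which response probabilities and effects are both linear. -/
lemma Model.convex_rationalizedEffects (h : Model μ β X α ε Y) (hvary : VaryingCovariates μ X)
    (k : Fin p) : Convex ℝ (rationalizedEffects k (μ.map fun ω => (X ω, Y ω))) := by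
  have hPX : IsProbabilityMeasure (μ.map X) :=
    Measure.isProbabilityMeasure_map h.measurable_X.aemeasurable
  intro d₁ hd₁ d₂ hd₂ a b ha hb hab
  rw [mem_rationalizedEffects_iff h hvary] at hd₁ hd₂ ⊢
  obtain ⟨κ₁, _, hlaw₁, rfl⟩ := hd₁
  obtain ⟨κ₂, _, hlaw₂, rfl⟩ := hd₂
  have hab' : ENNReal.ofReal a + ENNReal.ofReal b = 1 := by
    rw [← ENNReal.ofReal_add ha hb, hab, ENNReal.ofReal_one]
  let κ : Kernel (Covariates N p) ℝ :=
    { toFun := fun x => ENNReal.ofReal a • κ₁ x + ENNReal.ofReal b • κ₂ x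
      measurable' := by
        refine Measure.measurable_of_measurable_coe _ fun s hs => ?_
        simp only [Measure.add_apply, Measure.smul_apply, smul_eq_mul]
        exact ((κ₁.measurable_coe hs).const_mul _).add ((κ₂.measurable_coe hs).const_mul _) }
  have hκ : ∀ x, κ x = ENNReal.ofReal a • κ₁ x + ENNReal.ofReal b • κ₂ x := fun _ => rfl
  refine ⟨κ, ⟨fun x => ⟨?_⟩⟩, ?_, ?_⟩
  · simp [hκ, hab']
  · filter_upwards [hlaw₁, hlaw₂] with x h₁ h₂ A
    rw [hκ, responseLaw_mixture, h₁, h₂, ← add_mul, hab', one_mul]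
  · simp only [hκ, effect_mixture _ _ _ _ ha hb, smul_eq_mul]
    rw [integral_add ((integrable_effect β κ₁ _).const_mul a)
      ((integrable_effect β κ₂ _).const_mul b), integral_const_mul, integral_const_mul]
    ring

lemma Model.isBounded_rationalizedEffects (h : Model μ β X α ε Y) (hvary : VaryingCovariates μ X)
    (k : Fin p) :
    Bornology.IsBounded (rationalizedEffects k (μ.map fun ω => (X ω, Y ω))) := by
  have hPX : IsProbabilityMeasure (μ.map X) :=
    Measure.isProbabilityMeasure_map h.measurable_X.aemeasurable
  refine isBounded_iff_forall_norm_le.2 ⟨‖β k‖ * 1, fun d hd => ?_⟩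
  obtain ⟨κ, _, -, rfl⟩ := (mem_rationalizedEffects_iff h hvary k d).1 hd
  rw [norm_mul]
  refine mul_le_mul_of_nonneg_left ?_ (norm_nonneg _)
  exact (norm_integral_le_of_norm_le_const (C := 1)
    (Filter.Eventually.of_forall fun x => norm_effect_le β x (κ x))).trans (by simp)

lemma Model.ofReal_sub_le (h : Model μ β X α ε Y) (hvary : VaryingCovariates μ X) (k : Fin p)
    {d₁ d₂ : ℝ} (hd₁ : d₁ ∈ rationalizedEffects k (μ.map fun ω => (X ω, Y ω)))
    (hd₂ : d₂ ∈ rationalizedEffects k (μ.map fun ω => (X ω, Y ω))) :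
    ENNReal.ofReal (d₁ - d₂) ≤ ENNReal.ofReal (|β k| / 4 ^ (N + 1)) *
      ∫⁻ ω, ENNReal.ofReal (c μ β X Y 0 (X ω) * |lam (N + 2) (X ω) β|) ∂μ := by
  have hPX : IsProbabilityMeasure (μ.map X) :=
    Measure.isProbabilityMeasure_map h.measurable_X.aemeasurable
  obtain ⟨κ₁, _, hlaw₁, rfl⟩ := (mem_rationalizedEffects_iff h hvary k d₁).1 hd₁
  obtain ⟨κ₂, _, hlaw₂, rfl⟩ := (mem_rationalizedEffects_iff h hvary k d₂).1 hd₂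
  rw [h.lintegral_c_zero, ← mul_sub, ← integral_sub (integrable_effect β κ₁ _)
    (integrable_effect β κ₂ _)]
  have h4 : (0 : ℝ) ≤ (4 ^ (N + 1))⁻¹ := by positivity
  calc ENNReal.ofReal (β k * ∫ x, (effect β x (κ₁ x) - effect β x (κ₂ x)) ∂(μ.map X))
      ≤ ENNReal.ofReal (|β k| * ‖∫ x, (effect β x (κ₁ x) - effect β x (κ₂ x)) ∂(μ.map X)‖) := by
        refine ENNReal.ofReal_le_ofReal ((le_abs_self _).trans_eq ?_)
        rw [abs_mul, Real.norm_eq_abs]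
    _ ≤ ENNReal.ofReal |β k| *
        ∫⁻ x, ‖effect β x (κ₁ x) - effect β x (κ₂ x)‖ₑ ∂(μ.map X) := by
        rw [ENNReal.ofReal_mul (abs_nonneg _), ofReal_norm]
        gcongr
        exact enorm_integral_le_lintegral_enorm _
    _ ≤ ENNReal.ofReal |β k| * ∫⁻ x, ENNReal.ofReal (4 ^ (N + 1))⁻¹ *
        ENNReal.ofReal (|lam (N + 2) x β| * moment β x (condDistrib α X μ x) 1) ∂(μ.map X) := by
        refine mul_le_mul_right (lintegral_mono_ae ?_) _
        filter_upwards [hlaw₁, hlaw₂] with x h₁ h₂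
        rw [← ofReal_norm, ← ENNReal.ofReal_mul h4]
        refine ENNReal.ofReal_le_ofReal ?_
        rw [← moment_eq_of_responseLaw_eq h₂ (q := 1) (by simp), mul_comm, ← div_eq_mul_inv]
        exact abs_effect_sub_le fun A => (h₁ A).trans (h₂ A).symm
    _ = _ := by
        rw [lintegral_const_mul' _ _ ENNReal.ofReal_ne_top, ← mul_assoc,
          ← ENNReal.ofReal_mul (abs_nonneg _), div_eq_mul_inv]

lemma Model.identifiedSet_eq_Icc (h : Model μ β X α ε Y) (hvary : VaryingCovariates μ X)
    (k : Fin p) :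
    ∃ Δlo Δhi : ℝ, Δlo ≤ Δhi ∧
      identifiedSet k (μ.map fun ω => (X ω, Y ω)) = Set.Icc Δlo Δhi ∧
      ENNReal.ofReal (Δhi - Δlo) ≤ ENNReal.ofReal (|β k| / 4 ^ (N + 1)) *
        ∫⁻ ω, ENNReal.ofReal (c μ β X Y 0 (X ω) * |lam (N + 2) (X ω) β|) ∂μ := by
  set R := rationalizedEffects k (μ.map fun ω => (X ω, Y ω)) with hR
  have hne : (closure R).Nonempty := ⟨_, subset_closure (h.averageMarginalEffect_mem hvary k)⟩
  have hcomp : IsCompact (closure R) := (h.isBounded_rationalizedEffects hvary k).isCompact_closure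
  have hconn : IsConnected (closure R) :=
    ⟨hne, (h.convex_rationalizedEffects hvary k).closure.isPreconnected⟩
  have hIcc := eq_Icc_of_connected_compact hconn hcomp
  have hlo := hcomp.sInf_mem hne
  have hhi := hcomp.sSup_mem hne
  refine ⟨sInf (closure R), sSup (closure R), ?_, hIcc, ?_⟩
  · exact (hIcc.subset hhi).1
  · set M := ENNReal.ofReal (|β k| / 4 ^ (N + 1)) *
        ∫⁻ ω, ENNReal.ofReal (c μ β X Y 0 (X ω) * |lam (N + 2) (X ω) β|) ∂μ
    -- The bound on differences is a closed condition on pairs, so it extends from rationalized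
    -- values to the endpoints of the closure.
    have hclosed : IsClosed {q : ℝ × ℝ | ENNReal.ofReal (q.1 - q.2) ≤ M} :=
      isClosed_le (ENNReal.continuous_ofReal.comp (by fun_prop)) continuous_const
    have hsub : R ×ˢ R ⊆ {q : ℝ × ℝ | ENNReal.ofReal (q.1 - q.2) ≤ M} :=
      fun q hq => h.ofReal_sub_le hvary k hq.1 hq.2
    have := closure_minimal hsub hclosed
    rw [closure_prod_eq] at this
    exact this (Set.mk_mem_prod hhi hlo)

lemma Model.ae_of_identifiedSet_eq_singleton (h : Model μ β X α ε Y)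
    (hvary : VaryingCovariates μ X) {k : Fin p} (hk : β k ≠ 0) {d : ℝ}
    (hd : identifiedSet k (μ.map fun ω => (X ω, Y ω)) = {d}) :
    ∀ᵐ ω ∂μ, (∃ t : Fin N, |(X ω t.castSucc - X ω (Fin.last N)) ⬝ᵥ β| = 0) ∨
      2 * (condSupport μ X α (X ω)).encard ≤ ((N + 1 : ℕ) : ℕ∞) := by
  have hPX : IsProbabilityMeasure (μ.map X) :=
    Measure.isProbabilityMeasure_map h.measurable_X.aemeasurable
  -- As β_k ≠ 0, a singleton identified set pins down the mean effect itself, at d / β_k, for every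
  -- admissible kernel.
  have hae := ae_of_integral_effect_eq β (μ.map X) (condDistrib α X μ) (e := d / β k)
    fun κ hκ hlaw => by
      have hmem : β k * ∫ x, effect β x (κ x) ∂(μ.map X) ∈
          identifiedSet k (μ.map fun ω => (X ω, Y ω)) :=
        subset_closure ((mem_rationalizedEffects_iff h hvary k _).2
          ⟨κ, hκ, Filter.Eventually.of_forall hlaw, rfl⟩)
      rw [hd, Set.mem_singleton_iff] at hmem
      rw [eq_div_iff hk, mul_comm, hmem]
  filter_upwards [ae_of_ae_map h.measurable_X.aemeasurable hae] with ω hω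
  rwa [lam_top_eq_zero_iff] at hω

lemma Model.identifiedSet_eq_singleton (h : Model μ β X α ε Y) (hvary : VaryingCovariates μ X)
    {k : Fin p} (hk : β k = 0 ∨
      ∀ᵐ ω ∂μ, (∃ t : Fin N, |(X ω t.castSucc - X ω (Fin.last N)) ⬝ᵥ β| = 0) ∨
        2 * (condSupport μ X α (X ω)).encard ≤ ((N + 1 : ℕ) : ℕ∞)) :
    identifiedSet k (μ.map fun ω => (X ω, Y ω)) = {averageMarginalEffect μ k β X α} := by
  have hR : rationalizedEffects k (μ.map fun ω => (X ω, Y ω)) =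
      {averageMarginalEffect μ k β X α} := by
    refine Set.eq_singleton_iff_unique_mem.2 ⟨h.averageMarginalEffect_mem hvary k, fun d hd => ?_⟩
    obtain ⟨κ, _, hlaw, rfl⟩ := (mem_rationalizedEffects_iff h hvary k d).1 hd
    rw [h.averageMarginalEffect_eq (compProd_map_condDistrib h.measurable_α.aemeasurable).symm k]
    rcases hk with hk | hk
    · rw [hk, zero_mul, zero_mul]
    · congr 1
      refine integral_congr_ae ?_
      -- The equality of effects is measurable in x, so it can be checked on Ω, where the hypothesis
      -- is stated; measurability of the support condition is not needed.
      refine (ae_map_iff h.measurable_X.aemeasurable (measurableSet_eq_fun (measurable_effect β κ)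
        (measurable_effect β (condDistrib α X μ)))).2 ?_
      filter_upwards [hk, ae_of_ae_map h.measurable_X.aemeasurable hlaw] with ω hω hlawω
      rcases hω with hω | hω
      · exact effect_eq_of_lam_eq_zero hlawω ((lam_top_eq_zero_iff _ _).2 hω)
      · exact effect_eq_of_encard_support_le hlawω hω
  rw [identifiedSet, hR, closure_singleton]

end model

end FELogit

theorem proposition3 {Ω : Type*} [MeasurableSpace Ω] (μ : Measure Ω) [IsProbabilityMeasure μ]
    (N p : ℕ) (k : Fin p) (β₀ : Fin p → ℝ) (X : Ω → FELogit.Covariates N p) (α : Ω → ℝ)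
    (ε : Ω → Fin (N + 1) → ℝ) (Y : Ω → Fin (N + 1) → ℕ)
    (hmodel : FELogit.Model μ β₀ X α ε Y) (hvary : FELogit.VaryingCovariates μ X) :
    (∃ Δlo Δhi : ℝ, Δlo ≤ Δhi ∧
      FELogit.identifiedSet k (μ.map fun ω => (X ω, Y ω)) = Set.Icc Δlo Δhi ∧
      ENNReal.ofReal (Δhi - Δlo) ≤ ENNReal.ofReal (|β₀ k| / 4 ^ (N + 1)) *
        ∫⁻ ω, ENNReal.ofReal
          (FELogit.c μ β₀ X Y 0 (X ω) * |FELogit.lam (N + 2) (X ω) β₀|) ∂μ) ∧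
    (FELogit.identifiedSet k (μ.map fun ω => (X ω, Y ω)) =
        {FELogit.averageMarginalEffect μ k β₀ X α} ↔
      β₀ k = 0 ∨
        ∀ᵐ ω ∂μ, (∃ t : Fin N, |(X ω t.castSucc - X ω (Fin.last N)) ⬝ᵥ β₀| = 0) ∨
          2 * (FELogit.condSupport μ X α (X ω)).encard ≤ ((N + 1 : ℕ) : ℕ∞)) := by
  refine ⟨hmodel.identifiedSet_eq_Icc hvary k, fun h => ?_, hmodel.identifiedSet_eq_singleton hvary⟩
  by_cases hk : β₀ k = 0
  · exact Or.inl hk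
  · exact Or.inr (hmodel.ae_of_identifiedSet_eq_singleton hvary hk h)
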